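/- Notation. Let $d\ge 0$ be an integer, and let $\langle f,g\rangle=\int_{\mathbb R^d} f(x)\overline{g(x)}\,dx$ be the inner product of $L_2(\mathbb R^d)$ (complex-valued functions). For an invertible real $d\times d$ matrix $U$, $k\in\mathbb R^d$ and $f\in L_2(\mathbb R^d)$ put $f_{U;k}(x):=|\det U|^{1/2}f(Ux-k)$. For $\Phi\subset L_2(\mathbb R^d)$ let $\mathbf S(\Phi)$ be the closed linear span in $L_2(\mathbb R^d)$ of $\{\phi(\cdot-k):\phi\in\Phi,\ k\in\mathbb Z^d\}$, and let $\operatorname{len}(S):=\min\{\#\Phi: S=\mathbf S(\Phi)\}\in\{0,1,2,\dots,\infty\}$ for a shift-invariant closed subspace $S$. Let $M$ be an invertible real $d\times d$ matrix. A countable set $\Psi\subset L_2(\mathbb R^d)$ is a homogeneous $M$-framelet if there are $C_1,C_2>0$ with $$C_1\|f\|^2\le\sum_{j\in\mathbb Z}\sum_{\psi\in\Psi}\sum_{k\in\mathbb Z^d}|\langle f,\psi_{M^j;k}\rangle|^2\le C_2\|f\|^2\qquad\text{for all } f\in L_2(\mathbb R^d).$$ Given countable sets $\Psi,\tilde\Psi\subset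 L_2(\mathbb R^d)$ and a bijection $\psi\mapsto\tilde\psi$ from $\Psi$ onto $\tilde\Psi$, the pair $(\tilde\Psi,\Psi)$ is a homogeneous dual $M$-framelet if both $\Psi$ and $\tilde\Psi$ are homogeneous $M$-framelets and $$\sum_{j\in\mathbb Z}\sum_{\psi\in\Psi}\sum_{k\in\mathbb Z^d}\langle f,\psi_{M^j;k}\rangle\langle\tilde\psi_{M^j;k},g\rangle=\langle f,g\rangle\qquad\text{for all } f,g\in L_2(\mathbb R^d),$$ with the series converging absolutely. Corollary 4.2. Let $M$ be an invertible real $d\times d$ matrix. Let $\Psi$ and $\tilde\Psi$ be countable subsets of $L_2(\mathbb R^d)$ with a bijection $\psi\mapsto\tilde\psi$ between them such that $\sum_{\psi\in\Psi}\|\psi\|^2<\infty$ and $\sum_{\tilde\psi\in\tilde\Psi}\|\tilde\psi\|^2<\infty$. Suppose that $s:=\min(\operatorname{len}(\mathbf S(\Psi)),\operatorname{len}(\mathbf S(\tilde\Psi)))<\infty$. If $(\tilde\Psi,\Psi)$ is a homogeneous dual $M$-framelet, then there exist a set $H\subset\mathbf S(\Psi)$ with exactly $s$ elements, a set $\tilde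 H\subset\mathbf S(\tilde\Psi)$ with exactly $s$ elements, and a bijection between $H$ and $\tilde H$, such that $(\tilde H,H)$, with this bijection, is a homogeneous dual $M$-framelet. -/

import Mathlib

open MeasureTheory

noncomputable section

namespace Framelet

/-- The space `ℝ^d` with its Euclidean structure. -/
abbrev Rd (d : ℕ) : Type := EuclideanSpace ℝ (Fin d)

/-- The Hilbert space `L_2(ℝ^d)` of complex-valued square integrable functions (Lebesgue measure). -/
abbrev L2 (d : ℕ) : Type := Lp ℂ 2 (volume : Measure (Rd d))

/-- The lattice `ℤ^d`. -/
abbrev Zd (d : ℕ) : Type := Fin d → ℤ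

/-- The point of `ℝ^d` with integer coordinates `k`. -/
def latticePoint {d : ℕ} (k : Zd d) : Rd d := WithLp.toLp 2 (fun i => (k i : ℝ))

/-- The affine map `x ↦ U x - k` of `ℝ^d`. -/
def affineMap {d : ℕ} (U : GL (Fin d) ℝ) (k : Rd d) (x : Rd d) : Rd d :=
  Matrix.toEuclideanLin (U : Matrix (Fin d) (Fin d) ℝ) x - k

lemma measurable_affineMap {d : ℕ} (U : GL (Fin d) ℝ) (k : Rd d) :
    Measurable (affineMap U k) := by
  have h : Continuous (affineMap U k) :=
    (LinearMap.continuous_of_finiteDimensional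
      (Matrix.toEuclideanLin (U : Matrix (Fin d) (Fin d) ℝ))).sub continuous_const
  exact h.measurable

lemma map_affineMap_volume {d : ℕ} (U : GL (Fin d) ℝ) (k : Rd d) :
    Measure.map (affineMap U k) (volume : Measure (Rd d)) =
      ENNReal.ofReal |((U : Matrix (Fin d) (Fin d) ℝ).det)⁻¹| • volume := by
  have hdet : LinearMap.det (Matrix.toEuclideanLin (U : Matrix (Fin d) (Fin d) ℝ)) =
      (U : Matrix (Fin d) (Fin d) ℝ).det := by
    exact LinearMap.det_toLin (PiLp.basisFun 2 ℝ (Fin d)) (U : Matrix (Fin d) (Fin d) ℝ)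
  have hne : LinearMap.det (Matrix.toEuclideanLin (U : Matrix (Fin d) (Fin d) ℝ)) ≠ 0 := by
    rw [hdet]
    exact ((Matrix.isUnit_iff_isUnit_det _).1 U.isUnit).ne_zero
  have hL : Measurable (Matrix.toEuclideanLin (U : Matrix (Fin d) (Fin d) ℝ)) :=
    (LinearMap.continuous_of_finiteDimensional _).measurable
  have hT : Measurable (fun x : Rd d => x - k) := measurable_id.sub_const k
  have hcomp : affineMap U k =
      (fun x : Rd d => x - k) ∘ Matrix.toEuclideanLin (U : Matrix (Fin d) (Fin d) ℝ) := rfl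
  rw [hcomp, ← Measure.map_map hT hL,
    Measure.map_linearMap_addHaar_eq_smul_addHaar _ hne, hdet, Measure.map_smul,
    (measurePreserving_sub_right (volume : Measure (Rd d)) k).map_eq]

lemma memLp_dilate {d : ℕ} (U : GL (Fin d) ℝ) (k : Rd d) (f : L2 d) :
    MemLp (fun x : Rd d =>
      ((Real.sqrt |(U : Matrix (Fin d) (Fin d) ℝ).det| : ℝ) : ℂ) * f (affineMap U k x))
      2 (volume : Measure (Rd d)) := by
  have h : MemLp (f : Rd d → ℂ) 2 (Measure.map (affineMap U k) volume) := by
    rw [map_affineMap_volume]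
    exact (Lp.memLp f).smul_measure ENNReal.ofReal_ne_top
  exact (h.comp_of_map (measurable_affineMap U k).aemeasurable).const_mul _

/-- The element `f_{U;k}(x) = |det U|^{1/2} f(U x - k)` of `L_2(ℝ^d)`, for `f ∈ L_2(ℝ^d)`, an
invertible real matrix `U` and `k ∈ ℝ^d`. -/
def dilate {d : ℕ} (U : GL (Fin d) ℝ) (k : Rd d) (f : L2 d) : L2 d :=
  (memLp_dilate U k f).toLp

/-- The shift `f(· - k) = f_{I;k}` of `f ∈ L_2(ℝ^d)`. -/
def shift {d : ℕ} (k : Rd d) (f : L2 d) : L2 d := dilate 1 k f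

/-- The shift-invariant space `S(Φ)`: the closed linear span in `L_2(ℝ^d)` of the integer shifts
`φ(· - k)`, `φ ∈ Φ`, `k ∈ ℤ^d`. -/
def shiftSpace {d : ℕ} (Φ : Set (L2 d)) : Submodule ℂ (L2 d) :=
  (Submodule.span ℂ {f | ∃ φ ∈ Φ, ∃ k : Zd d, f = shift (latticePoint k) φ}).topologicalClosure

/-- The length `len(S) = min {#Φ : S = S(Φ)}` of a shift-invariant space, where `#Φ` is valued in
`{0, 1, 2, …, ∞}`. -/
def len {d : ℕ} (S : Submodule ℂ (L2 d)) : ℕ∞ :=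
  sInf {n | ∃ Φ : Set (L2 d), S = shiftSpace Φ ∧ n = Φ.encard}

/-- The homogeneous `M`-affine system `AS(Ψ)`: the family `ψ_{M^j;k}`, indexed by the triples
`(j, ψ, k)` with `j ∈ ℤ`, `ψ ∈ Ψ`, `k ∈ ℤ^d`. -/
def affineSystem {d : ℕ} (M : GL (Fin d) ℝ) (Ψ : Set (L2 d)) (p : ℤ × Ψ × Zd d) : L2 d :=
  dilate (M ^ p.1) (latticePoint p.2.2) (p.2.1 : L2 d)

/-- The family `h` is a frame of the Hilbert space `E`: there are `C₁, C₂ > 0` with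
`C₁ ‖f‖² ≤ ∑ |⟨f, h_i⟩|² ≤ C₂ ‖f‖²` for all `f`. -/
def IsFrame {ι E : Type*} [NormedAddCommGroup E] [InnerProductSpace ℂ E] (h : ι → E) : Prop :=
  ∃ C₁ C₂ : ℝ, 0 < C₁ ∧ 0 < C₂ ∧ ∀ f : E,
    Summable (fun i => ‖inner ℂ (h i) f‖ ^ 2) ∧
    C₁ * ‖f‖ ^ 2 ≤ ∑' i, ‖inner ℂ (h i) f‖ ^ 2 ∧
    ∑' i, ‖inner ℂ (h i) f‖ ^ 2 ≤ C₂ * ‖f‖ ^ 2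

/-- `Ψ` is a homogeneous `M`-framelet in `L_2(ℝ^d)`. -/
def IsHomogeneousFramelet {d : ℕ} (M : GL (Fin d) ℝ) (Ψ : Set (L2 d)) : Prop :=
  Ψ.Countable ∧ IsFrame (affineSystem M Ψ)

/-- `(Ψ', Ψ)` is a homogeneous dual `M`-framelet in `L_2(ℝ^d)`, where the elements of `Ψ` and `Ψ'`
are paired by the bijection `e : Ψ ≃ Ψ'`: both are homogeneous `M`-framelets and
`∑_{j, ψ, k} ⟨f, ψ_{M^j;k}⟩ ⟨(e ψ)_{M^j;k}, g⟩ = ⟨f, g⟩` for all `f`, `g`, with absolute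
convergence. Here `⟨f, g⟩ = ∫ f(x) conj(g(x)) dx` is linear in `f`, i.e. it is `inner ℂ g f`. -/
structure IsHomogeneousDualFramelet {d : ℕ} (M : GL (Fin d) ℝ) (Ψ' Ψ : Set (L2 d))
    (e : Ψ ≃ Ψ') : Prop where
  primal : IsHomogeneousFramelet M Ψ
  dual : IsHomogeneousFramelet M Ψ'
  summable_norm : ∀ f g : L2 d, Summable (fun p : ℤ × Ψ × Zd d =>
    ‖inner ℂ (affineSystem M Ψ p) f * inner ℂ g (affineSystem M Ψ' (p.1, e p.2.1, p.2.2))‖)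
  tsum_eq : ∀ f g : L2 d, ∑' p : ℤ × Ψ × Zd d,
    inner ℂ (affineSystem M Ψ p) f * inner ℂ g (affineSystem M Ψ' (p.1, e p.2.1, p.2.2)) =
      inner ℂ g f

end Framelet

end

/-!
Let `A, A' : L_2(ℝ^d) → K := ℓ²(Ψ × ℤ^d)` be the analysis operators `f ↦ (⟨f, ψ(· - k)⟩)` of the
integer shifts of `Ψ` and `Ψ'`; the level `j = 0` of the affine systems makes them bounded. With
`D_j` the unitary dilation by `M ^ j`, the upper framelet bound says `∑_j ‖A D_j⁎ f‖² ≤ C ‖f‖²`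
and duality says `∑_j ⟨A D_j⁎ f, A' D_j⁎ g⟩ = ⟨f, g⟩`. So a pair of families `h, h'` of any size,
with analysis operators `B, B'`, is again a homogeneous dual framelet as soon as
`‖B f‖ ≤ ‖A f‖`, `‖B' f‖ ≤ ‖A' f‖` and `⟨B f, B' g⟩ = ⟨A f, A' g⟩`
(`IsDualFrame.of_analysis`); the lower bounds come from duality and the two upper bounds.

By symmetry let `S(Ψ)` be generated by `φ_1, …, φ_s`. The operators intertwine the shifts with the
translations `U_k` of `K`, so the range of `A` lies in any closed translation-invariant subspace `R`
containing the `A φ_l`. Such an `R` has `s` *Parseval generators* `p_l`, meaning that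
`∑_{l, k} |⟨x, U_k p_l⟩|² = ‖P_R x‖²` (`exists_parsevalGenerator_translation`). Then
`h_l = A⁎ p_l` and `h'_l = A'⁎ p_l` work: their analysis operators are `W A` and `W A'`, where `W`
is a partial isometry with initial space `R`.

Parseval generators are found by Gram-Schmidt, which reduces to cyclic subspaces. A cyclic subspace
with generator `r` is equivalent to a cyclic subspace of the regular representation `ℓ²(ℤ^d)` as
soon as some `a ∈ ℓ²(ℤ^d)` has the same matrix coefficients `⟨U_k r, r⟩`
(`exists_parsevalGenerator_cyclic`), and the `a` whose Fourier series is `(∑_i |r̂_i|²)^{1/2}` has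
them (`exists_correlation_eq`).

To get exactly `s` elements the families `h` and `h'` have to be injective. Parseval generators
remain so under a constant orthogonal matrix, and a suitable Householder reflection separates the
entries of `h` and of `h'` at once, both families being nonzero (`exists_householder_injective`).
-/

open MeasureTheory

noncomputable section

namespace Framelet

/-! ### Dilations and shifts of `L_2(ℝ^d)` -/

section Dilate

variable {d : ℕ}

lemma coeFn_dilate (U : GL (Fin d) ℝ) (k : Rd d) (f : L2 d) :
    dilate U k f =ᵐ[volume] fun x =>
      ((Real.sqrt |(U : Matrix (Fin d) (Fin d) ℝ).det| : ℝ) : ℂ) * f (affineMap U k x) :=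
  (memLp_dilate U k f).coeFn_toLp

lemma quasiMeasurePreserving_affineMap (U : GL (Fin d) ℝ) (k : Rd d) :
    Measure.QuasiMeasurePreserving (affineMap U k) volume volume := by
  refine ⟨measurable_affineMap U k, ?_⟩
  rw [map_affineMap_volume]
  exact Measure.smul_absolutelyContinuous

lemma dilate_dilate (U V : GL (Fin d) ℝ) (k m : Rd d) (f : L2 d) :
    dilate U k (dilate V m f) =
      dilate (V * U) (Matrix.toEuclideanLin (V : Matrix (Fin d) (Fin d) ℝ) k + m) f := by
  apply Lp.ext
  filter_upwards [coeFn_dilate U k (dilate V m f),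
    (quasiMeasurePreserving_affineMap U k).ae_eq (coeFn_dilate V m f),
    coeFn_dilate (V * U) (Matrix.toEuclideanLin (V : Matrix (Fin d) (Fin d) ℝ) k + m) f]
    with x h₁ h₂ h₃
  simp only [Function.comp_apply] at h₂
  have h : affineMap V m (affineMap U k x) = affineMap (V * U)
      (Matrix.toEuclideanLin (V : Matrix (Fin d) (Fin d) ℝ) k + m) x := by
    simp only [affineMap, map_sub, Units.val_mul, Matrix.toLpLin_mul_same, LinearMap.comp_apply]
    abel
  rw [h₁, h₂, h₃, h, Units.val_mul, Matrix.det_mul, abs_mul, Real.sqrt_mul (abs_nonneg _)]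
  push_cast
  ring

lemma dilate_add (U : GL (Fin d) ℝ) (k : Rd d) (f g : L2 d) :
    dilate U k (f + g) = dilate U k f + dilate U k g := by
  apply Lp.ext
  filter_upwards [coeFn_dilate U k (f + g), coeFn_dilate U k f, coeFn_dilate U k g,
    (quasiMeasurePreserving_affineMap U k).ae_eq (Lp.coeFn_add f g),
    Lp.coeFn_add (dilate U k f) (dilate U k g)] with x h₁ h₂ h₃ h₄ h₅
  simp only [Function.comp_apply, Pi.add_apply] at h₄ h₅
  rw [h₁, h₄, h₅, h₂, h₃, mul_add]

lemma dilate_smul (U : GL (Fin d) ℝ) (k : Rd d) (c : ℂ) (f : L2 d) :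
    dilate U k (c • f) = c • dilate U k f := by
  apply Lp.ext
  filter_upwards [coeFn_dilate U k (c • f), coeFn_dilate U k f,
    (quasiMeasurePreserving_affineMap U k).ae_eq (Lp.coeFn_smul c f),
    Lp.coeFn_smul c (dilate U k f)] with x h₁ h₂ h₃ h₄
  simp only [Function.comp_apply, Pi.smul_apply, smul_eq_mul] at h₃ h₄
  rw [h₁, h₃, h₄, h₂]
  ring

lemma norm_dilate (U : GL (Fin d) ℝ) (k : Rd d) (f : L2 d) : ‖dilate U k f‖ = ‖f‖ := by
  have hdet : 0 < |(U : Matrix (Fin d) (Fin d) ℝ).det| :=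
    abs_pos.2 ((Matrix.isUnit_iff_isUnit_det _).1 U.isUnit).ne_zero
  have h : eLpNorm (fun x => f (affineMap U k x)) 2 volume =
      eLpNorm f 2 (Measure.map (affineMap U k) volume) :=
    (eLpNorm_map_measure ((Lp.aestronglyMeasurable f).mono_ac
      (quasiMeasurePreserving_affineMap U k).absolutelyContinuous)
      (measurable_affineMap U k).aemeasurable).symm
  rw [dilate, Lp.norm_toLp, Lp.norm_def]
  congr 1
  change eLpNorm (((Real.sqrt |(U : Matrix (Fin d) (Fin d) ℝ).det| : ℝ) : ℂ) •
    fun x => f (affineMap U k x)) 2 volume = _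
  rw [eLpNorm_const_smul, h, map_affineMap_volume,
    eLpNorm_smul_measure_of_ne_top ENNReal.ofNat_ne_top]
  rw [smul_eq_mul, ← mul_assoc, ← ofReal_norm,
    show (1 / 2 : ENNReal).toReal = 1 / (2 : ℝ) by simp,
    ENNReal.ofReal_rpow_of_pos (by rw [abs_inv]; positivity), ← ENNReal.ofReal_mul (norm_nonneg _)]
  have : ‖((Real.sqrt |(U : Matrix (Fin d) (Fin d) ℝ).det| : ℝ) : ℂ)‖ *
      |((U : Matrix (Fin d) (Fin d) ℝ).det)⁻¹| ^ (1 / (2 : ℝ)) = 1 := by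
    rw [Complex.norm_real, Real.norm_of_nonneg (Real.sqrt_nonneg _), ← Real.sqrt_eq_rpow, abs_inv,
      Real.sqrt_inv]
    exact mul_inv_cancel₀ (Real.sqrt_pos.2 hdet).ne'
  rw [this, ENNReal.ofReal_one, one_mul]

/-- `f ↦ f_{U;k}` as a linear isometry of `L_2(ℝ^d)`. -/
def dilateₗᵢ (U : GL (Fin d) ℝ) (k : Rd d) : L2 d →ₗᵢ[ℂ] L2 d where
  toFun := dilate U k
  map_add' := dilate_add U k
  map_smul' := dilate_smul U k
  norm_map' := norm_dilate U k

lemma dilate_eq_dilate_shift (U : GL (Fin d) ℝ) (k : Rd d) (f : L2 d) :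
    dilate U k f = dilate U 0 (shift k f) := by
  rw [shift, dilate_dilate]; simp

lemma shift_shift (k m : Rd d) (f : L2 d) : shift k (shift m f) = shift (k + m) f := by
  rw [shift, shift, dilate_dilate, shift]; simp

lemma shift_zero (f : L2 d) : shift 0 f = f := by
  apply Lp.ext
  filter_upwards [coeFn_dilate 1 0 f] with x h
  rw [shift, h]
  simp [affineMap]

lemma latticePoint_add (k m : Zd d) :
    latticePoint (k + m) = latticePoint k + latticePoint m := by
  ext i; simp [latticePoint]

lemma latticePoint_zero : latticePoint (0 : Zd d) = 0 := by
  ext i; simp [latticePoint]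

end Dilate

/-! ### Parseval generators of unitary representations -/

/-- `U` is a unitary representation of the additive group `G` on `K`. Each `U g` is only required to
be a linear isometry; it is onto because `U (-g)` inverts it. -/
structure IsUnitaryAction {G K : Type*} [AddGroup G] [NormedAddCommGroup K]
    [InnerProductSpace ℂ K] (U : G → K →ₗᵢ[ℂ] K) : Prop where
  zero : ∀ x, U 0 x = x
  add : ∀ g h x, U (g + h) x = U g (U h x)

section Action

variable {G K L : Type*} [AddCommGroup G]
  [NormedAddCommGroup K] [InnerProductSpace ℂ K]
  [NormedAddCommGroup L] [InnerProductSpace ℂ L]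

lemma IsUnitaryAction.inner_left {U : G → K →ₗᵢ[ℂ] K} (hU : IsUnitaryAction U) (g : G) (x y : K) :
    inner ℂ (U g x) y = inner ℂ x (U (-g) y) := by
  rw [← (U (-g)).inner_map_map (U g x) y, ← hU.add, neg_add_cancel, hU.zero]

/-- The orbits of the vectors `p i` under `U` form a Parseval frame of the closed subspace `R`:
`∑_{i, g} |⟨x, U g (p i)⟩|² = ‖P_R x‖²` for all `x` of the whole space. In particular the orbits lie
in `R`, since the left side vanishes on `Rᗮ`. -/
def IsParsevalGenerator {ι : Type*} (U : G → K →ₗᵢ[ℂ] K) (p : ι → K) (R : Submodule ℂ K)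
    [R.HasOrthogonalProjection] : Prop :=
  ∀ x : K, HasSum (fun i : ι × G => ‖inner ℂ (U i.2 (p i.1)) x‖ ^ 2) (‖R.starProjection x‖ ^ 2)

lemma starProjection_comm {U : G → K →ₗᵢ[ℂ] K} (hU : IsUnitaryAction U) (R : Submodule ℂ K)
    [R.HasOrthogonalProjection] (hR : ∀ g, ∀ x ∈ R, U g x ∈ R) (g : G) (x : K) :
    R.starProjection (U g x) = U g (R.starProjection x) := by
  refine (Submodule.eq_starProjection_of_mem_of_inner_eq_zero
    (hR g _ (Submodule.starProjection_apply_mem _ _)) fun w hw => ?_)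
  rw [← map_sub, hU.inner_left]
  exact Submodule.starProjection_inner_eq_zero _ _ (hR _ _ hw)

/-- The cyclic subspace of `r`: the closed linear span of its orbit under `U`. -/
def cyclicSpace (U : G → K →ₗᵢ[ℂ] K) (r : K) : Submodule ℂ K :=
  (Submodule.span ℂ (Set.range fun g => U g r)).topologicalClosure

lemma mem_cyclicSpace_self {U : G → K →ₗᵢ[ℂ] K} (hU : IsUnitaryAction U) (r : K) :
    r ∈ cyclicSpace U r :=
  Submodule.le_topologicalClosure _ (Submodule.subset_span ⟨0, hU.zero r⟩)

instance [CompleteSpace K] (U : G → K →ₗᵢ[ℂ] K) (r : K) : CompleteSpace (cyclicSpace U r) :=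
  (Submodule.isClosed_topologicalClosure _).completeSpace_coe

omit [AddCommGroup G] in
lemma cyclicSpace_le {U : G → K →ₗᵢ[ℂ] K} {r : K} {R : Submodule ℂ K}
    (hRc : IsClosed (R : Set K)) (h : ∀ g, U g r ∈ R) : cyclicSpace U r ≤ R :=
  Submodule.topologicalClosure_minimal _
    (Submodule.span_le.2 (by rintro _ ⟨g, rfl⟩; exact h g)) hRc

lemma map_mem_cyclicSpace {U : G → K →ₗᵢ[ℂ] K} (hU : IsUnitaryAction U) (r : K) (g : G) :
    ∀ x ∈ cyclicSpace U r, U g x ∈ cyclicSpace U r := by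
  intro x hx
  have : cyclicSpace U r ≤ (cyclicSpace U r).comap (U g).toLinearMap := by
    refine cyclicSpace_le ?_ fun m => ?_
    · exact (Submodule.isClosed_topologicalClosure _).preimage (U g).continuous
    · change U g (U m r) ∈ cyclicSpace U r
      rw [← hU.add]
      exact Submodule.le_topologicalClosure _ (Submodule.subset_span ⟨_, rfl⟩)
  exact this hx

/-- Vectors with the same matrix coefficients generate equivalent cyclic representations: `W` is the
extension of `U g r ↦ V g a`, by continuity to the cyclic subspace of `r` and by zero to its
orthogonal complement. -/
lemma exists_intertwiner [CompleteSpace K] [CompleteSpace L]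
    {U : G → K →ₗᵢ[ℂ] K} (hU : IsUnitaryAction U)
    {V : G → L →ₗᵢ[ℂ] L} (hV : IsUnitaryAction V) (r : K) (a : L)
    (hra : ∀ g, inner ℂ (U g r) r = inner ℂ (V g a) a) :
    ∃ W : K →L[ℂ] L, (∀ x, ‖W x‖ = ‖(cyclicSpace U r).starProjection x‖) ∧
      ∀ g x, W (U g x) = V g (W x) := by
  set C := cyclicSpace U r with hC
  let T : (G →₀ ℂ) →ₗ[ℂ] K := Finsupp.linearCombination ℂ fun g => U g r
  let S : (G →₀ ℂ) →ₗ[ℂ] L := Finsupp.linearCombination ℂ fun g => V g a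
  have hTS : ∀ c, ‖S c‖ = ‖T c‖ := by
    intro c
    -- both Gram matrices depend on the matrix coefficients only
    have h2 : inner ℂ (S c) (S c) = inner ℂ (T c) (T c) := by
      simp only [S, T, Finsupp.linearCombination_apply, Finsupp.sum, sum_inner, inner_sum,
        inner_smul_left, inner_smul_right]
      refine Finset.sum_congr rfl fun i _ => congrArg _ (Finset.sum_congr rfl fun j _ => ?_)
      congr 1
      have e₁ := hV.inner_left (-i) (V j a) a
      have e₂ := hU.inner_left (-i) (U j r) r
      rw [neg_neg, ← hV.add] at e₁
      rw [neg_neg, ← hU.add] at e₂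
      rw [← e₁, ← e₂, hra]
    rw [inner_self_eq_norm_sq_to_K, inner_self_eq_norm_sq_to_K] at h2
    have h3 : ‖S c‖ ^ 2 = ‖T c‖ ^ 2 := by exact_mod_cast h2
    exact (sq_eq_sq₀ (norm_nonneg _) (norm_nonneg _)).1 h3
  have hTC : ∀ c, T c ∈ C := fun c => Submodule.le_topologicalClosure _ (by
    rw [← Finsupp.range_linearCombination]; exact ⟨c, rfl⟩)
  let T' : (G →₀ ℂ) →ₗ[ℂ] C := T.codRestrict C hTC
  have hd : DenseRange T' := by
    rw [DenseRange, dense_iff_closure_eq, Set.eq_univ_iff_forall]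
    rintro ⟨x, hx⟩
    rw [closure_subtype]
    have : ((↑) '' Set.range T' : Set K) =
        (Submodule.span ℂ (Set.range fun g => U g r) : Set K) := by
      rw [← Finsupp.range_linearCombination]
      ext y
      simp [T', T, LinearMap.codRestrict]
    rw [this]
    exact hx
  have hn : ∀ c, ‖S c‖ ≤ 1 * ‖T' c‖ := fun c => by rw [one_mul, hTS]; rfl
  let W₀ : C →L[ℂ] L := S.extendOfNorm T'
  have hW₀ : ∀ c, W₀ (T' c) = S c := LinearMap.extendOfNorm_eq hd ⟨1, hn⟩
  have hW₀n : ∀ x : C, ‖W₀ x‖ = ‖x‖ := by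
    intro x
    induction x using hd.induction_on with
    | hp => exact isClosed_eq (by fun_prop) (by fun_prop)
    | ih c => rw [hW₀, hTS]; rfl
  let W : K →L[ℂ] L := W₀.comp C.orthogonalProjectionOnto
  have hWn : ∀ x, ‖W x‖ = ‖C.starProjection x‖ := fun x => hW₀n _
  refine ⟨W, hWn, fun g x => ?_⟩
  have hWP : ∀ x, W (C.starProjection x) = W x := by
    intro x
    have : ‖W (x - C.starProjection x)‖ = 0 := by
      rw [hWn, map_sub, Submodule.starProjection_eq_self_iff.2 (C.starProjection_apply_mem x),
        sub_self, norm_zero]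
    rw [norm_eq_zero, map_sub, sub_eq_zero] at this
    exact this.symm
  have hWr : ∀ g, W (U g r) = V g a := by
    intro g
    have h1 : T' (Finsupp.single g 1) = ⟨U g r, map_mem_cyclicSpace hU r g _
        (mem_cyclicSpace_self hU r)⟩ := by
      ext; simp [T', T]
    have h2 : C.orthogonalProjectionOnto (U g r) = T' (Finsupp.single g 1) := by
      rw [h1]
      exact Submodule.orthogonalProjectionOnto_mem_subspace_eq_self (K := C) ⟨U g r, _⟩
    have h3 : W (U g r) = W₀ (C.orthogonalProjectionOnto (U g r)) := rfl
    rw [h3, h2, hW₀]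
    simp [S]
  -- on `Cᗮ` both sides vanish, so equivariance has to be checked on the orbit of `r` only
  have key : C ≤ LinearMap.eqLocus (W.toLinearMap ∘ₗ (U g).toLinearMap)
      ((V g).toLinearMap ∘ₗ W.toLinearMap) := by
    refine cyclicSpace_le ?_ fun m => ?_
    · exact isClosed_eq (W.continuous.comp (U g).continuous) ((V g).continuous.comp W.continuous)
    · change W (U g (U m r)) = V g (W (U m r))
      rw [← hU.add, hWr, hWr, hV.add]
  have h1 : W (U g (C.starProjection x)) = V g (W (C.starProjection x)) :=
    key (C.starProjection_apply_mem x)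
  rw [← hWP (U g x), starProjection_comm hU C (map_mem_cyclicSpace hU r), h1, hWP]

/-- If `V` is the regular representation, permuting the basis `b` simply transitively, then the
adjoint of the intertwiner carries `b 0` to a Parseval generator of the cyclic subspace. -/
lemma exists_parsevalGenerator_cyclic [CompleteSpace K] [CompleteSpace L]
    {U : G → K →ₗᵢ[ℂ] K} (hU : IsUnitaryAction U)
    {V : G → L →ₗᵢ[ℂ] L} (hV : IsUnitaryAction V) (b : HilbertBasis G ℂ L)
    (hb : ∀ g, V g (b 0) = b g) (r : K) (a : L)
    (hra : ∀ g, inner ℂ (U g r) r = inner ℂ (V g a) a) :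
    ∃ p : K, IsParsevalGenerator U (fun _ : Unit => p) (cyclicSpace U r) := by
  obtain ⟨W, hWn, hWU⟩ := exists_intertwiner hU hV r a hra
  refine ⟨W.adjoint (b 0), fun x => ?_⟩
  rw [← (Equiv.punitProd G).symm.hasSum_iff, ← hWn]
  have h : ∀ g, inner ℂ (U g (W.adjoint (b 0))) x = inner ℂ (b g) (W x) := by
    intro g
    rw [hU.inner_left, ContinuousLinearMap.adjoint_inner_left, hWU, ← hV.inner_left, hb]
  have h2 := b.hasSum_inner_mul_inner (W x) (W x)
  rw [inner_self_eq_norm_sq_to_K] at h2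
  have h3 : (fun g => inner ℂ (W x) (b g) * inner ℂ (b g) (W x)) =
      fun g => ((‖inner ℂ (b g) (W x)‖ ^ 2 : ℝ) : ℂ) := by
    ext g
    rw [← inner_conj_symm, Complex.conj_mul']
    norm_cast
  rw [h3] at h2
  have h4 : HasSum (fun g => ((‖inner ℂ (b g) (W x)‖ ^ 2 : ℝ) : ℂ)) ((‖W x‖ ^ 2 : ℝ) : ℂ) := by
    rwa [Complex.ofReal_pow]
  rw [Complex.hasSum_ofReal] at h4
  convert h4 using 2 with g
  simp [h]

/-- Gram-Schmidt: the orthogonal component of each new vector generates a cyclic subspace orthogonal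
to the previous ones, and contributes one Parseval generator. -/
lemma exists_parsevalGenerator [CompleteSpace K] [CompleteSpace L]
    {U : G → K →ₗᵢ[ℂ] K} (hU : IsUnitaryAction U)
    {V : G → L →ₗᵢ[ℂ] L} (hV : IsUnitaryAction V) (b : HilbertBasis G ℂ L)
    (hb : ∀ g, V g (b 0) = b g)
    (hreg : ∀ r : K, ∃ a : L, ∀ g, inner ℂ (U g r) r = inner ℂ (V g a) a)
    {n : ℕ} (r : Fin n → K) :
    ∃ (R : Submodule ℂ K) (_ : CompleteSpace R) (p : Fin n → K),
      (∀ g, ∀ x ∈ R, U g x ∈ R) ∧ (∀ i, r i ∈ R) ∧ IsParsevalGenerator U p R := by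
  induction n with
  | zero =>
    refine ⟨⊥, inferInstance, Fin.elim0, ?_, fun i => i.elim0, fun x => ?_⟩
    · rintro g x hx
      rw [Submodule.mem_bot] at hx ⊢
      rw [hx, map_zero]
    · simp only [Submodule.starProjection_bot]
      simp
  | succ n ih =>
    obtain ⟨R, hRc, p, hRU, hrR, hp⟩ := ih (fun i => r i.castSucc)
    -- the component of the last vector orthogonal to `R`
    set r' := r (Fin.last n) - R.starProjection (r (Fin.last n)) with hr'
    obtain ⟨a, ha⟩ := hreg r'
    obtain ⟨q, hq⟩ := exists_parsevalGenerator_cyclic hU hV b hb r' a ha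
    set C := cyclicSpace U r' with hC
    have hCR : C ≤ Rᗮ := by
      refine cyclicSpace_le R.isClosed_orthogonal fun g => ?_
      rw [Submodule.mem_orthogonal']
      intro w hw
      rw [hU.inner_left]
      exact Submodule.starProjection_inner_eq_zero _ _ (hRU _ _ hw)
    have hort : ∀ x ∈ R, ∀ y ∈ C, inner ℂ x y = 0 := fun x hx y hy =>
      (Submodule.mem_orthogonal R y).1 (hCR hy) x hx
    have hort' : ∀ x ∈ R, ∀ y ∈ C, inner ℂ y x = 0 := fun x hx y hy =>
      (Submodule.mem_orthogonal' R y).1 (hCR hy) x hx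
    let R' := (R ⊔ C).topologicalClosure
    have hR'c : CompleteSpace R' := (Submodule.isClosed_topologicalClosure _).completeSpace_coe
    have hRR' : R ≤ R' := le_sup_left.trans (Submodule.le_topologicalClosure _)
    have hCR' : C ≤ R' := le_sup_right.trans (Submodule.le_topologicalClosure _)
    have hproj : ∀ x, R'.starProjection x = R.starProjection x + C.starProjection x := by
      intro x
      refine (Submodule.eq_starProjection_of_mem_of_inner_eq_zero (R'.add_mem
        (hRR' (R.starProjection_apply_mem x)) (hCR' (C.starProjection_apply_mem x))) ?_)
      have h1 : R ⊔ C ≤ (ℂ ∙ (x - (R.starProjection x + C.starProjection x)))ᗮ := by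
        refine sup_le (fun w hw => ?_) (fun w hw => ?_) <;>
          rw [Submodule.mem_orthogonal_singleton_iff_inner_right]
        · rw [← sub_sub, inner_sub_left, Submodule.starProjection_inner_eq_zero _ _ hw,
            hort' w hw _ (C.starProjection_apply_mem x), sub_zero]
        · rw [add_comm, ← sub_sub, inner_sub_left, Submodule.starProjection_inner_eq_zero _ _ hw,
            hort _ (R.starProjection_apply_mem x) w hw, sub_zero]
      intro w hw
      exact (Submodule.mem_orthogonal_singleton_iff_inner_right).1
        (Submodule.topologicalClosure_minimal _ h1 (Submodule.isClosed_orthogonal _) hw)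
    refine ⟨R', hR'c, Fin.snoc p q, ?_, ?_, ?_⟩
    · intro g
      have h1 : R ⊔ C ≤ R'.comap (U g).toLinearMap := by
        refine sup_le (fun w hw => hRR' (hRU g w hw)) (fun w hw => ?_)
        exact hCR' (map_mem_cyclicSpace hU r' g w hw)
      exact Submodule.topologicalClosure_minimal _ h1
        ((Submodule.isClosed_topologicalClosure _).preimage (U g).continuous)
    · intro i
      refine Fin.lastCases ?_ (fun j => hRR' (hrR j)) i
      have : r (Fin.last n) = r' + R.starProjection (r (Fin.last n)) := by rw [hr']; abel
      rw [this]
      exact R'.add_mem (hCR' (mem_cyclicSpace_self hU r')) (hRR' (R.starProjection_apply_mem _))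
    · intro x
      have hpy : ‖R'.starProjection x‖ ^ 2 =
          ‖R.starProjection x‖ ^ 2 + ‖C.starProjection x‖ ^ 2 := by
        rw [hproj, sq, sq, sq]
        exact norm_add_sq_eq_norm_sq_add_norm_sq_of_inner_eq_zero _ _
          (hort _ (R.starProjection_apply_mem x) _ (C.starProjection_apply_mem x))
      rw [hpy]
      let e : (Fin n × G) ⊕ (Unit × G) ≃ Fin (n + 1) × G :=
        (Equiv.sumProdDistrib (Fin n) Unit G).symm.trans
          (((Equiv.refl _).sumCongr finOneEquiv.symm |>.trans finSumFinEquiv).prodCongr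
            (Equiv.refl G))
      rw [← e.hasSum_iff]
      refine HasSum.sum (f := (fun i : Fin (n + 1) × G =>
        ‖inner ℂ (U i.2 ((Fin.snoc p q : Fin (n + 1) → K) i.1)) x‖ ^ 2) ∘ e) ?_ ?_
      · convert hp x using 2 with i
        have h : (Fin.snoc p q : Fin (n + 1) → K) (Fin.castAdd 1 i.1) = p i.1 :=
          Fin.snoc_castSucc (α := fun _ => K) q p i.1
        simp [e, h]
      · convert hq x using 2 with i
        have h : (Fin.snoc p q : Fin (n + 1) → K) (Fin.natAdd n (finOneEquiv.symm i.1)) = q :=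
          Fin.snoc_last (α := fun _ => K) q p
        simp [e, h]

end Action

/-- The isometry `x ↦ x ∘ σ` of `ℓ²(J)` that permutes the coordinates by `σ`. -/
def lpReindex {J : Type*} (σ : Equiv.Perm J) :
    lp (fun _ : J => ℂ) 2 →ₗᵢ[ℂ] lp (fun _ : J => ℂ) 2 where
  toFun x := ⟨fun j => x (σ j), by
    have h := (memℓp_gen_iff (by simp)).1 (lp.memℓp x)
    exact (memℓp_gen_iff (E := fun _ : J => ℂ) (by simp)).2 ((Equiv.summable_iff σ).2 h)⟩
  map_add' _ _ := rfl
  map_smul' _ _ := rfl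
  norm_map' x := by
    rw [lp.norm_eq_tsum_rpow (by simp), lp.norm_eq_tsum_rpow (by simp)]
    congr 1
    exact Equiv.tsum_eq σ fun j => ‖x j‖ ^ (2 : ENNReal).toReal

@[simp] lemma lpReindex_apply {J : Type*} (σ : Equiv.Perm J) (x : lp (fun _ : J => ℂ) 2) (j : J) :
    lpReindex σ x j = x (σ j) := rfl

/-- The translation `(translation I g x) (i, m) = x (i, m - g)` of `ℓ²(I × G)`, which is a multiple
of the regular representation of `G`. -/
def translation {G : Type*} [AddCommGroup G] (I : Type*) (g : G) :
    lp (fun _ : I × G => ℂ) 2 →ₗᵢ[ℂ] lp (fun _ : I × G => ℂ) 2 :=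
  lpReindex ((Equiv.refl I).prodCongr (Equiv.subRight g))

lemma translation_apply {G : Type*} [AddCommGroup G] (I : Type*) (g : G)
    (x : lp (fun _ : I × G => ℂ) 2) (i : I × G) : translation I g x i = x (i.1, i.2 - g) := rfl

lemma isUnitaryAction_translation (G : Type*) [AddCommGroup G] (I : Type*) :
    IsUnitaryAction (translation (G := G) I) where
  zero x := by ext i; simp [translation_apply]
  add g h x := by ext i; simp [translation_apply, sub_sub]

/-! ### Autocorrelations and Fourier series on the torus -/

section Torus

open UnitAddTorus
open scoped ComplexConjugate ENNReal

/-- The circle carries the Haar probability measure, the normalisation used in Mathlib for Fourier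
series on `UnitAddTorus`. -/
local instance : MeasureSpace UnitAddCircle := ⟨AddCircle.haarAddCircle⟩

local instance : Measure.IsAddHaarMeasure (volume : Measure UnitAddCircle) :=
  inferInstanceAs (Measure.IsAddHaarMeasure AddCircle.haarAddCircle)

local instance : IsProbabilityMeasure (volume : Measure UnitAddCircle) :=
  inferInstanceAs (IsProbabilityMeasure AddCircle.haarAddCircle)

variable {d : ℕ}

/-- The autocorrelation of the Fourier coefficients of `f` consists of the Fourier coefficients of
`|f|²`. -/
lemma hasSum_mFourierCoeff_correlation (f : Lp ℂ 2 (volume : Measure (UnitAddTorus (Fin d))))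
    (k : Zd d) :
    HasSum (fun m => conj (mFourierCoeff f (m - k)) * mFourierCoeff f m)
      (∫ t, mFourier (-k) t * ((‖f t‖ ^ 2 : ℝ) : ℂ)) := by
  have hmem : MemLp (fun t => mFourier k t * f t) 2
      (volume : Measure (UnitAddTorus (Fin d))) := by
    refine (Lp.memLp f).of_le_mul (c := 1) ((mFourier k).continuous.aestronglyMeasurable.mul
      (Lp.aestronglyMeasurable f)) (Filter.Eventually.of_forall fun t => ?_)
    rw [norm_mul]
    gcongr
    exact ((mFourier k).norm_coe_le_norm t).trans mFourier_norm.le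
  have h := hasSum_prod_mFourierCoeff hmem.toLp f
  have hc : ∀ m, mFourierCoeff hmem.toLp m = mFourierCoeff f (m - k) := by
    intro m
    refine integral_congr_ae ?_
    filter_upwards [hmem.coeFn_toLp] with t ht
    rw [ht, smul_eq_mul, smul_eq_mul, ← mul_assoc, ← mFourier_add]
    congr 3
    abel
  simp only [hc] at h
  convert h using 1
  refine integral_congr_ae ?_
  filter_upwards [hmem.coeFn_toLp] with t ht
  rw [ht, map_mul, mFourier_neg, mul_assoc, Complex.conj_mul']
  norm_cast

lemma integrable_norm_sq_coeFn {α : Type*} [MeasurableSpace α] {μ : Measure α} (f : Lp ℂ 2 μ) :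
    Integrable (fun t => ‖f t‖ ^ 2) μ :=
  (memLp_two_iff_integrable_sq_norm (Lp.aestronglyMeasurable _)).1 (Lp.memLp _)

/-- The square function `(∑_i |F_i|²)^{1/2}` of a square-summable family lies in `L²`. The real
`tsum` is zero where the series diverges, which is a null set. -/
lemma exists_norm_sq_eq_tsum_norm_sq {α I : Type*} [MeasurableSpace α] {μ : Measure α}
    [Countable I] (F : I → Lp ℂ 2 μ) (hF : Summable fun i => ∫ t, ‖F i t‖ ^ 2 ∂μ) :
    ∃ v : Lp ℂ 2 μ, ∀ᵐ t ∂μ, ‖v t‖ ^ 2 = ∑' i, ‖F i t‖ ^ 2 := by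
  let w : α → ℝ := fun t => ∑' i, ‖F i t‖ ^ 2
  have hw0 : ∀ t, 0 ≤ w t := fun t => tsum_nonneg fun i => by positivity
  have hwint : Integrable w μ := by
    have h1 : w = fun t => (∑' i, ‖F i t‖ₑ ^ 2).toReal := by
      ext t
      rw [ENNReal.tsum_toReal_eq (fun i => by finiteness)]
      simp [w]
    -- `tsum` in `ℝ` agrees with `toReal` of the sum in `ℝ≥0∞` also where the series diverges
    rw [h1]
    refine integrable_toReal_of_lintegral_ne_top ?_ ?_
    · exact AEMeasurable.tsum fun i => (Lp.aestronglyMeasurable _).enorm.pow_const 2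
    · rw [lintegral_tsum fun i => (Lp.aestronglyMeasurable _).enorm.pow_const 2]
      have h2 : ∀ i, ∫⁻ t, ‖F i t‖ₑ ^ 2 ∂μ = ENNReal.ofReal (∫ t, ‖F i t‖ ^ 2 ∂μ) := by
        intro i
        rw [ofReal_integral_eq_lintegral_ofReal (integrable_norm_sq_coeFn _)
          (Filter.Eventually.of_forall fun t => by positivity)]
        refine lintegral_congr fun t => ?_
        rw [ENNReal.ofReal_pow (norm_nonneg _), ofReal_norm]
      simp only [h2]
      exact hF.tsum_ofReal_ne_top
  let u : α → ℂ := fun t => (Real.sqrt (w t) : ℂ)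
  have hu2 : ∀ t, ‖u t‖ ^ 2 = w t := fun t => by
    rw [Complex.norm_real, Real.norm_of_nonneg (Real.sqrt_nonneg _), Real.sq_sqrt (hw0 t)]
  have hu : MemLp u 2 μ := by
    refine (memLp_two_iff_integrable_sq_norm ?_).2 (by simpa only [hu2] using hwint)
    exact Complex.continuous_ofReal.comp_aestronglyMeasurable
      (Real.continuous_sqrt.comp_aestronglyMeasurable hwint.1)
  refine ⟨hu.toLp u, ?_⟩
  filter_upwards [hu.coeFn_toLp] with t ht
  rw [ht, hu2]

lemma norm_mFourier_apply_le (k : Zd d) (t : UnitAddTorus (Fin d)) : ‖mFourier k t‖ ≤ 1 :=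
  ((mFourier k).norm_coe_le_norm t).trans mFourier_norm.le

lemma hasSum_integral_mFourier_mul_norm_sq {I : Type*} [Countable I]
    (F : I → Lp ℂ 2 (volume : Measure (UnitAddTorus (Fin d))))
    (hF : Summable fun i => ∫ t, ‖F i t‖ ^ 2) (k : Zd d) :
    HasSum (fun i => ∫ t, mFourier k t * ((‖F i t‖ ^ 2 : ℝ) : ℂ))
      (∫ t, mFourier k t * ((∑' i, ‖F i t‖ ^ 2 : ℝ) : ℂ)) := by
  have hI := hasSum_integral_of_summable_integral_norm
    (F := fun i t => mFourier k t * ((‖F i t‖ ^ 2 : ℝ) : ℂ)) (μ := volume)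
    (fun i => ?_) ?_
  · simpa only [tsum_mul_left, Complex.ofReal_tsum] using hI
  · exact (integrable_norm_sq_coeFn (F i)).ofReal.bdd_mul (c := 1)
      (mFourier k).continuous.aestronglyMeasurable
      (Filter.Eventually.of_forall (norm_mFourier_apply_le k))
  · refine hF.of_nonneg_of_le (fun i => integral_nonneg fun t => norm_nonneg _) fun i => ?_
    refine integral_mono_of_nonneg (Filter.Eventually.of_forall fun t => norm_nonneg _)
      (integrable_norm_sq_coeFn (F i)) (Filter.Eventually.of_forall fun t => ?_)
    simp only [norm_mul, Complex.norm_real, norm_pow, norm_norm]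
    exact mul_le_of_le_one_left (by positivity) (norm_mFourier_apply_le k t)

lemma hasSum_inner_lp {J : Type*} (x y : lp (fun _ : J => ℂ) 2) :
    HasSum (fun j => conj (x j) * y j) (inner ℂ x y) := by
  simpa only [RCLike.inner_apply'] using lp.hasSum_inner (𝕜 := ℂ) x y

/-- Every matrix coefficient of `ℓ²(I × ℤ^d)` is a matrix coefficient of `ℓ²(ℤ^d)`: its spectral
density `∑_i |r̂_i|²` is integrable, and `a` has the square root of the density as its Fourier
series. -/
lemma exists_correlation_eq {I : Type*} [Countable I] (r : lp (fun _ : I × Zd d => ℂ) 2) :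
    ∃ a : lp (fun _ : Zd d => ℂ) 2, ∀ k,
      inner ℂ (translation I k r) r = inner ℂ (lpReindex (Equiv.subRight k) a) a := by
  have hr : Summable fun j : I × Zd d => ‖r j‖ ^ 2 := by
    have h := (memℓp_gen_iff (by simp)).1 (lp.memℓp r)
    simpa using h
  obtain ⟨c, hc⟩ : ∃ c : I → lp (fun _ : Zd d => ℂ) 2, ∀ i m, c i m = r (i, m) := by
    refine ⟨fun i => ⟨fun m => r (i, m),
      (memℓp_gen_iff (E := fun _ : Zd d => ℂ) (by simp)).2 ?_⟩, fun i m => rfl⟩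
    have h : Summable fun m : Zd d => ‖r (i, m)‖ ^ 2 :=
      hr.comp_injective (Prod.mk_right_injective i)
    simpa using h
  obtain ⟨F, hF⟩ : ∃ F : I → Lp ℂ 2 (volume : Measure (UnitAddTorus (Fin d))),
      ∀ i m, mFourierCoeff (F i) m = r (i, m) := by
    refine ⟨fun i => mFourierBasis.repr.symm (c i), fun i m => ?_⟩
    rw [← mFourierBasis_repr, LinearIsometryEquiv.apply_symm_apply, hc]
  have hFsum : Summable fun i => ∫ t, ‖F i t‖ ^ 2 := by
    have h : ∀ i, ∫ t, ‖F i t‖ ^ 2 = ∑' m, ‖r (i, m)‖ ^ 2 := fun i => by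
      rw [← (hasSum_sq_mFourierCoeff (F i)).tsum_eq]
      simp only [hF]
    simp only [h]
    exact hr.prod
  obtain ⟨v, hv⟩ := exists_norm_sq_eq_tsum_norm_sq F hFsum
  obtain ⟨a, ha⟩ : ∃ a : lp (fun _ : Zd d => ℂ) 2, ∀ m, a m = mFourierCoeff v m :=
    ⟨mFourierBasis.repr v, mFourierBasis_repr v⟩
  refine ⟨a, fun k => ?_⟩
  have hI := (hasSum_integral_mFourier_mul_norm_sq F hFsum (-k)).tsum_eq
  have h1 : ∫ t, mFourier (-k) t * ((∑' i, ‖F i t‖ ^ 2 : ℝ) : ℂ) =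
      ∫ t, mFourier (-k) t * ((‖v t‖ ^ 2 : ℝ) : ℂ) := by
    refine integral_congr_ae ?_
    filter_upwards [hv] with t ht
    rw [ht]
  rw [h1, ← (hasSum_mFourierCoeff_correlation v k).tsum_eq] at hI
  have hprod := (hasSum_inner_lp (translation I k r) r).summable.tsum_prod
  rw [(hasSum_inner_lp _ _).tsum_eq] at hprod
  rw [hprod, ← (hasSum_inner_lp _ _).tsum_eq]
  simp only [lpReindex_apply, translation_apply, ha, Equiv.subRight_apply]
  rw [← hI]
  refine tsum_congr fun i => ?_
  rw [← (hasSum_mFourierCoeff_correlation (F i) k).tsum_eq]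
  simp only [hF]

end Torus

/-- Finitely many vectors of `ℓ²(I × ℤ^d)` lie in a closed translation-invariant subspace that has
equally many Parseval generators. -/
lemma exists_parsevalGenerator_translation {d : ℕ} {I : Type*} [Countable I] {n : ℕ}
    (r : Fin n → lp (fun _ : I × Zd d => ℂ) 2) :
    ∃ (R : Submodule ℂ (lp (fun _ : I × Zd d => ℂ) 2)) (_ : CompleteSpace R)
      (p : Fin n → lp (fun _ : I × Zd d => ℂ) 2),
      (∀ g, ∀ x ∈ R, translation I g x ∈ R) ∧ (∀ i, r i ∈ R) ∧
        IsParsevalGenerator (translation I) p R := by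
  classical
  have hV : IsUnitaryAction fun k : Zd d => lpReindex (Equiv.subRight k) :=
    { zero := fun x => by ext i; simp
      add := fun g h x => by ext i; simp [sub_sub] }
  refine exists_parsevalGenerator (isUnitaryAction_translation (Zd d) I) hV
    (HilbertBasis.ofRepr (LinearIsometryEquiv.refl ℂ _)) (fun g => ?_) exists_correlation_eq r
  ext m
  rw [lpReindex_apply, ← HilbertBasis.repr_symm_single, ← HilbertBasis.repr_symm_single]
  change (lp.single 2 (0 : Zd d) (1 : ℂ) : lp (fun _ : Zd d => ℂ) 2) (m - g) =
    (lp.single 2 g (1 : ℂ) : lp (fun _ : Zd d => ℂ) 2) m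
  simp [lp.single_apply, Pi.single_apply, sub_eq_zero]

/-! ### Householder reflections -/

section Householder

variable {n : ℕ} {E : Type*} [AddCommGroup E] [Module ℂ E]

/-- The Householder reflection `1 - 2 z zᵀ / |z|²` of a real vector `z`, applied to a column `v` of
vectors of a complex space. It is orthogonal if `z ≠ 0`. -/
def householder (z : Fin n → ℝ) (v : Fin n → E) (l : Fin n) : E :=
  v l - ((2 * z l / ∑ m, z m ^ 2 : ℝ) : ℂ) • ∑ m, (z m : ℂ) • v m

lemma map_householder {F : Type*} [AddCommGroup F] [Module ℂ F] (T : E →ₗ[ℂ] F) (z : Fin n → ℝ)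
    (v : Fin n → E) (l : Fin n) : T (householder z v l) = householder z (T ∘ v) l := by
  simp [householder]

lemma inner_householder_left {F : Type*} [NormedAddCommGroup F] [InnerProductSpace ℂ F]
    (z : Fin n → ℝ) (v : Fin n → F) (l : Fin n) (x : F) :
    inner ℂ (householder z v l) x = householder z (fun m => inner ℂ (v m) x) l := by
  simp only [householder, inner_sub_left, inner_smul_left, sum_inner, Complex.conj_ofReal,
    smul_eq_mul]

lemma sum_norm_sq_householder (z : Fin n → ℝ) (hz : ∑ m, z m ^ 2 ≠ 0) (c : Fin n → ℂ) :
    ∑ l, ‖householder z c l‖ ^ 2 = ∑ l, ‖c l‖ ^ 2 := by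
  set N := ∑ m, z m ^ 2 with hN
  set S := ∑ m, (z m : ℂ) • c m with hS
  have h1 : ∀ l, ‖householder z c l‖ ^ 2 =
      ‖c l‖ ^ 2 - 4 / N * inner ℝ (z l • c l) S + 4 * ‖S‖ ^ 2 / N ^ 2 * z l ^ 2 := by
    intro l
    rw [householder, ← hN, ← hS, Complex.coe_smul, norm_sub_sq_real, norm_smul, mul_pow,
      Real.norm_eq_abs, sq_abs, inner_smul_right, real_inner_smul_left]
    field_simp
    ring
  have h2 : ∑ l, inner ℝ (z l • c l) S = ‖S‖ ^ 2 := by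
    rw [← sum_inner, ← real_inner_self_eq_norm_sq]
    rfl
  simp only [h1, Finset.sum_add_distrib, Finset.sum_sub_distrib, ← Finset.mul_sum, h2, ← hN]
  field_simp
  ring

open Polynomial in
/-- The vector `z = (1, t, t², …)` has these properties for all but finitely many real `t`: two
entries of a reflected vector agree only if `t` solves a nontrivial polynomial equation. -/
lemma exists_householder_injective (v w : Fin n → ℂ) (hv : v ≠ 0) (hw : w ≠ 0) :
    ∃ z : Fin n → ℝ, ∑ m, z m ^ 2 ≠ 0 ∧ Function.Injective (householder z v) ∧
      Function.Injective (householder z w) := by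
  classical
  -- `P u (i, j)` at `t` is `|z|²` times the difference of the reflected entries `i` and `j` of `u`
  let Q : ℂ[X] := ∑ m : Fin n, (X ^ (m : ℕ)) ^ 2
  let P : (Fin n → ℂ) → Fin n × Fin n → ℂ[X] := fun u q =>
    Q * C (u q.1 - u q.2) -
      2 * (X ^ (q.1 : ℕ) - X ^ (q.2 : ℕ)) * ∑ m : Fin n, X ^ (m : ℕ) * C (u m)
  have hP : ∀ u : Fin n → ℂ, u ≠ 0 → ∀ q : Fin n × Fin n, q.1 ≠ q.2 → P u q ≠ 0 := by
    intro u hu q hq h0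
    have hn : (n : ℂ) ≠ 0 := by
      have := q.1.pos
      exact_mod_cast this.ne'
    -- at `t = 1` only the first summand is left
    have h1 : u q.1 - u q.2 = 0 := by
      have := congrArg (eval 1) h0
      simpa [P, Q, eval_finsetSum, hn] using this
    have h2 : (X ^ (q.1 : ℕ) - X ^ (q.2 : ℕ) : ℂ[X]) ≠ 0 := by
      rw [sub_ne_zero]
      intro h
      exact hq (Fin.ext (by simpa using congrArg natDegree h))
    have h3 : (∑ m : Fin n, X ^ (m : ℕ) * C (u m) : ℂ[X]) ≠ 0 := by
      obtain ⟨i, hi⟩ := Function.ne_iff.1 hu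
      intro h
      apply hi
      have := congrArg (fun p : ℂ[X] => p.coeff i) h
      simpa [finsetSum_coeff, coeff_X_pow, Fin.val_inj, eq_comm] using this
    simp only [P, h1, map_zero, mul_zero, zero_sub, neg_eq_zero] at h0
    exact mul_ne_zero (mul_ne_zero two_ne_zero h2) h3 h0
  let D := (Finset.univ : Finset (Fin n × Fin n)).filter fun q => q.1 ≠ q.2
  have hD : ∏ q ∈ D, (P v q * P w q) ≠ 0 := by
    refine Finset.prod_ne_zero_iff.2 fun q hq => ?_
    have hq' : q.1 ≠ q.2 := (Finset.mem_filter.1 hq).2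
    exact mul_ne_zero (hP v hv q hq') (hP w hw q hq')
  obtain ⟨t, ht⟩ : ∃ t : ℝ, eval (t : ℂ) (∏ q ∈ D, (P v q * P w q)) ≠ 0 := by
    by_contra! h
    refine hD (eq_zero_of_infinite_isRoot _ ?_)
    exact (Set.infinite_range_of_injective Complex.ofReal_injective).mono
      (by rintro _ ⟨t, rfl⟩; exact h t)
  rw [eval_prod, Finset.prod_ne_zero_iff] at ht
  let z : Fin n → ℝ := fun m => t ^ (m : ℕ)
  have hz : ∑ m, z m ^ 2 ≠ 0 := by
    obtain ⟨i, -⟩ := Function.ne_iff.1 hv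
    have : 0 < ∑ m, z m ^ 2 :=
      Finset.sum_pos' (fun m _ => sq_nonneg _) ⟨⟨0, i.pos⟩, Finset.mem_univ _, by simp [z]⟩
    exact this.ne'
  have hzC : (∑ m, (z m : ℂ) ^ 2) ≠ 0 := by exact_mod_cast hz
  have key : ∀ u : Fin n → ℂ, (∀ q ∈ D, eval (t : ℂ) (P u q) ≠ 0) →
      Function.Injective (householder z u) := by
    intro u hu i j hij
    by_contra hne
    refine hu (i, j) (Finset.mem_filter.2 ⟨Finset.mem_univ _, hne⟩) ?_
    simp only [householder, smul_eq_mul] at hij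
    push_cast at hij
    simp only [P, Q, eval_sub, eval_mul, eval_finsetSum, eval_pow, eval_X, eval_C, eval_ofNat]
    have hz' : ∀ m, (z m : ℂ) = (t : ℂ) ^ (m : ℕ) := fun m => by simp [z]
    simp only [hz'] at hij hzC
    field_simp at hij
    linear_combination hij
  refine ⟨z, hz, key v fun q hq => ?_, key w fun q hq => ?_⟩
  · have := ht q hq
    rw [eval_mul] at this
    exact left_ne_zero_of_mul this
  · have := ht q hq
    rw [eval_mul] at this
    exact right_ne_zero_of_mul this

end Householder

lemma hasSum_prod_fintype_iff {ι G : Type*} [Fintype ι] {f : ι × G → ℝ} (hf : 0 ≤ f) {a : ℝ} :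
    HasSum f a ↔ HasSum (fun g => ∑ i, f (i, g)) a := by
  rw [← (Equiv.prodComm G ι).hasSum_iff]
  constructor
  · intro h
    exact h.prod_fiberwise fun g => hasSum_fintype _
  · intro h
    have hs : Summable (f ∘ Equiv.prodComm G ι) := by
      refine (summable_prod_of_nonneg (f := f ∘ Equiv.prodComm G ι) fun q => hf _).2
        ⟨fun g => (hasSum_fintype _).summable, ?_⟩
      simp only [tsum_fintype]
      exact h.summable
    have h2 := hs.hasSum.prod_fiberwise fun g => hasSum_fintype _
    rw [← h2.unique h]
    exact hs.hasSum

lemma IsParsevalGenerator.householder {G K : Type*} [NormedAddCommGroup K]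
    [InnerProductSpace ℂ K] {n : ℕ} {U : G → K →ₗᵢ[ℂ] K} {p : Fin n → K} {R : Submodule ℂ K}
    [R.HasOrthogonalProjection] (hp : IsParsevalGenerator U p R) {z : Fin n → ℝ}
    (hz : ∑ m, z m ^ 2 ≠ 0) : IsParsevalGenerator U (householder z p) R := by
  intro x
  have h := hp x
  rw [hasSum_prod_fintype_iff (fun _ => by positivity)] at h ⊢
  convert h using 2 with g
  have h1 : ∀ l, inner ℂ (U g (Framelet.householder z p l)) x =
      Framelet.householder z (fun m => inner ℂ (U g (p m)) x) l := by
    intro l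
    have := map_householder (U g).toLinearMap z p l
    rw [LinearIsometry.coe_toLinearMap] at this
    rw [this, inner_householder_left]
    rfl
  simp only [h1]
  exact sum_norm_sq_householder z hz _

/-! ### Bessel families and dual frames -/

section Frames

variable {J E : Type*} [NormedAddCommGroup E] [InnerProductSpace ℂ E]

/-- `u` is a Bessel family with bound `C`: `∑ |⟨f, u_i⟩|² ≤ C ‖f‖²` for all `f`. -/
def IsBessel (u : J → E) (C : ℝ) : Prop :=
  ∀ f : E, Summable (fun i => ‖inner ℂ (u i) f‖ ^ 2) ∧ ∑' i, ‖inner ℂ (u i) f‖ ^ 2 ≤ C * ‖f‖ ^ 2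

lemma IsFrame.exists_isBessel {u : J → E} (hu : IsFrame u) : ∃ C, 0 < C ∧ IsBessel u C := by
  obtain ⟨_, C, _, hC, h⟩ := hu
  exact ⟨C, hC, fun f => ⟨(h f).1, (h f).2.2⟩⟩

lemma IsBessel.comp_injective {J' : Type*} {u : J → E} {C : ℝ} (hu : IsBessel u C) {φ : J' → J}
    (hφ : Function.Injective φ) : IsBessel (u ∘ φ) C := fun f =>
  have hs : Summable fun i => ‖inner ℂ ((u ∘ φ) i) f‖ ^ 2 := (hu f).1.comp_injective hφ
  ⟨hs, (hs.tsum_le_tsum_of_inj φ hφ (fun _ _ => by positivity) (fun _ => le_rfl) (hu f).1).trans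
    (hu f).2⟩

lemma IsFrame.comp_equiv_iff {J' : Type*} {u : J → E} (φ : J' ≃ J) :
    IsFrame (u ∘ φ) ↔ IsFrame u := by
  have h1 : ∀ f, Summable (fun i => ‖inner ℂ ((u ∘ φ) i) f‖ ^ 2) ↔
      Summable (fun i => ‖inner ℂ (u i) f‖ ^ 2) := fun f =>
    φ.summable_iff (f := fun i => ‖inner ℂ (u i) f‖ ^ 2)
  have h2 : ∀ f, ∑' i, ‖inner ℂ ((u ∘ φ) i) f‖ ^ 2 = ∑' i, ‖inner ℂ (u i) f‖ ^ 2 := fun f =>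
    φ.tsum_eq (fun i => ‖inner ℂ (u i) f‖ ^ 2)
  simp only [IsFrame, h1, h2]

/-- `u` and `v` are dual frames: both are frames, and `∑ ⟨f, u_i⟩ ⟨v_i, g⟩ = ⟨f, g⟩` with absolute
convergence. -/
structure IsDualFrame (u v : J → E) : Prop where
  left : IsFrame u
  right : IsFrame v
  summable_norm : ∀ f g : E, Summable fun i => ‖inner ℂ (u i) f * inner ℂ g (v i)‖
  tsum_eq : ∀ f g : E, ∑' i, inner ℂ (u i) f * inner ℂ g (v i) = inner ℂ g f

lemma IsDualFrame.comp_equiv_iff {J' : Type*} {u v : J → E} (φ : J' ≃ J) :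
    IsDualFrame (u ∘ φ) (v ∘ φ) ↔ IsDualFrame u v := by
  have h1 : ∀ f g, Summable (fun i => ‖inner ℂ ((u ∘ φ) i) f * inner ℂ g ((v ∘ φ) i)‖) ↔
      Summable (fun i => ‖inner ℂ (u i) f * inner ℂ g (v i)‖) := fun f g =>
    φ.summable_iff (f := fun i => ‖inner ℂ (u i) f * inner ℂ g (v i)‖)
  have h2 : ∀ f g, ∑' i, inner ℂ ((u ∘ φ) i) f * inner ℂ g ((v ∘ φ) i) =
      ∑' i, inner ℂ (u i) f * inner ℂ g (v i) := fun f g =>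
    φ.tsum_eq (fun i => inner ℂ (u i) f * inner ℂ g (v i))
  constructor
  · rintro ⟨a, b, c, e⟩
    exact ⟨(IsFrame.comp_equiv_iff φ).1 a, (IsFrame.comp_equiv_iff φ).1 b,
      fun f g => (h1 f g).1 (c f g), fun f g => (h2 f g).symm.trans (e f g)⟩
  · rintro ⟨a, b, c, e⟩
    exact ⟨(IsFrame.comp_equiv_iff φ).2 a, (IsFrame.comp_equiv_iff φ).2 b,
      fun f g => (h1 f g).2 (c f g), fun f g => (h2 f g).trans (e f g)⟩

lemma mul_inner_swap (a b f g : E) :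
    inner ℂ b f * inner ℂ g a = starRingEnd ℂ (inner ℂ a g * inner ℂ f b) := by
  rw [map_mul, inner_conj_symm, inner_conj_symm, mul_comm]

lemma IsDualFrame.symm {u v : J → E} (h : IsDualFrame u v) : IsDualFrame v u where
  left := h.right
  right := h.left
  summable_norm f g := by
    simp only [fun i => mul_inner_swap (u i) (v i) f g, RCLike.norm_conj]
    exact h.summable_norm g f
  tsum_eq f g := by
    simp only [fun i => mul_inner_swap (u i) (v i) f g]
    rw [← Complex.conj_tsum, h.tsum_eq, inner_conj_symm]

lemma summable_norm_inner_mul_inner {u v : J → E} {C D : ℝ} (hu : IsBessel u C)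
    (hv : IsBessel v D) (f g : E) : Summable fun i => ‖inner ℂ (u i) f * inner ℂ g (v i)‖ := by
  refine ((hu f).1.add (hv g).1).of_nonneg_of_le (fun i => norm_nonneg _) fun i => ?_
  rw [norm_mul, ← norm_inner_symm (v i)]
  nlinarith [sq_nonneg (‖inner ℂ (u i) f‖ - ‖inner ℂ (v i) g‖), sq_nonneg ‖inner ℂ (u i) f‖,
    sq_nonneg ‖inner ℂ (v i) g‖]

/-- For Bessel families the reproducing formula forces the lower frame bound `D⁻¹`. -/
lemma isFrame_of_isBessel_of_tsum_eq {u v : J → E} {C D : ℝ} (hC : 0 < C) (hD : 0 < D)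
    (hu : IsBessel u C) (hv : IsBessel v D)
    (h : ∀ f : E, ∑' i, inner ℂ (u i) f * inner ℂ f (v i) = inner ℂ f f) : IsFrame u := by
  refine ⟨D⁻¹, C, inv_pos.2 hD, hC, fun f => ⟨(hu f).1, ?_, (hu f).2⟩⟩
  have hs := summable_norm_inner_mul_inner hu hv f f
  have h1 : ‖f‖ ^ 2 ≤ ∑' i, ‖inner ℂ (u i) f * inner ℂ f (v i)‖ := by
    have h2 := norm_tsum_le_tsum_norm hs
    rwa [h f, inner_self_eq_norm_sq_to_K, ← RCLike.ofReal_pow, RCLike.norm_ofReal,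
      abs_of_nonneg (by positivity)] at h2
  -- the inequality `2ab ≤ D a² + b² / D` absorbs the dual coefficients
  have h2 : ∑' i, ‖inner ℂ (u i) f * inner ℂ f (v i)‖ ≤
      ∑' i, (D / 2 * ‖inner ℂ (u i) f‖ ^ 2 + (2 * D)⁻¹ * ‖inner ℂ (v i) f‖ ^ 2) := by
    refine hs.tsum_le_tsum (fun i => ?_) (((hu f).1.mul_left _).add ((hv f).1.mul_left _))
    rw [norm_mul, ← norm_inner_symm (v i)]
    have h3 : D / 2 * ‖inner ℂ (u i) f‖ ^ 2 + (2 * D)⁻¹ * ‖inner ℂ (v i) f‖ ^ 2 -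
        ‖inner ℂ (u i) f‖ * ‖inner ℂ (v i) f‖ =
        (2 * D)⁻¹ * (D * ‖inner ℂ (u i) f‖ - ‖inner ℂ (v i) f‖) ^ 2 := by
      field_simp
      ring
    have h4 : 0 ≤ (2 * D)⁻¹ * (D * ‖inner ℂ (u i) f‖ - ‖inner ℂ (v i) f‖) ^ 2 := by positivity
    linarith
  rw [((hu f).1.mul_left _).tsum_add ((hv f).1.mul_left _), tsum_mul_left, tsum_mul_left] at h2
  have h5 : (2 * D)⁻¹ * ∑' i, ‖inner ℂ (v i) f‖ ^ 2 ≤ ‖f‖ ^ 2 / 2 := by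
    calc _ ≤ (2 * D)⁻¹ * (D * ‖f‖ ^ 2) := by gcongr; exact (hv f).2
      _ = _ := by field_simp
  rw [inv_mul_le_iff₀ hD]
  linarith

lemma isDualFrame_of_isBessel {u v : J → E} {C D : ℝ} (hC : 0 < C) (hD : 0 < D)
    (hu : IsBessel u C) (hv : IsBessel v D)
    (h : ∀ f g : E, ∑' i, inner ℂ (u i) f * inner ℂ g (v i) = inner ℂ g f) :
    IsDualFrame u v where
  left := isFrame_of_isBessel_of_tsum_eq hC hD hu hv fun f => h f f
  right := by
    refine isFrame_of_isBessel_of_tsum_eq hD hC hv hu fun f => ?_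
    simp only [fun i => mul_inner_swap (u i) (v i) f f]
    rw [← Complex.conj_tsum, h, inner_conj_symm]
  summable_norm := summable_norm_inner_mul_inner hu hv
  tsum_eq := h

/-- The analysis operator `f ↦ (⟨f, u_j⟩)_j` of a Bessel family. -/
lemma IsBessel.exists_analysis {u : J → E} {C : ℝ} (hu : IsBessel u C) :
    ∃ A : E →L[ℂ] lp (fun _ : J => ℂ) 2, ∀ f j, A f j = inner ℂ (u j) f := by
  let A₀ : E →ₗ[ℂ] lp (fun _ : J => ℂ) 2 :=
    { toFun := fun f => ⟨fun j => inner ℂ (u j) f,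
        (memℓp_gen_iff (E := fun _ : J => ℂ) (by simp)).2 (by simpa using (hu f).1)⟩
      map_add' := fun f g => by ext j; exact inner_add_right _ _ _
      map_smul' := fun c f => by ext j; exact inner_smul_right _ _ _ }
  refine ⟨A₀.mkContinuous (Real.sqrt C) fun f => ?_, fun f j => rfl⟩
  have h : ‖A₀ f‖ ^ 2 = ∑' i, ‖inner ℂ (u i) f‖ ^ 2 := by
    have := lp.norm_rpow_eq_tsum (p := 2) (by simp) (A₀ f)
    simp only [ENNReal.toReal_ofNat, Real.rpow_ofNat] at this
    exact this
  have h2 := (hu f).2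
  rw [← h] at h2
  rcases le_or_gt 0 C with hC | hC
  · rw [← Real.sqrt_sq (norm_nonneg (A₀ f)), ← Real.sqrt_sq (norm_nonneg f),
      ← Real.sqrt_mul hC]
    exact Real.sqrt_le_sqrt h2
  · have h3 : ‖A₀ f‖ ^ 2 ≤ 0 := h2.trans (mul_nonpos_of_nonpos_of_nonneg hC.le (sq_nonneg _))
    rw [pow_eq_zero_iff two_ne_zero |>.1 (le_antisymm h3 (sq_nonneg _))]
    positivity

lemma hasSum_norm_sq_lp (x : lp (fun _ : J => ℂ) 2) : HasSum (fun j => ‖x j‖ ^ 2) (‖x‖ ^ 2) := by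
  simpa using lp.hasSum_norm (p := 2) (by simp) x

end Frames

/-! ### Affine systems -/

section AffineSystem

variable {d : ℕ}

/-- The affine system of a family `h` indexed by an arbitrary type; `affineSystem M Ψ` is the case
of the inclusion of `Ψ`. -/
def affineFamily (M : GL (Fin d) ℝ) {I : Type*} (h : I → L2 d) (p : ℤ × I × Zd d) : L2 d :=
  dilate (M ^ p.1) (latticePoint p.2.2) (h p.2.1)

/-- `A` is the analysis operator `f ↦ (⟨f, h_i(· - k)⟩)_{i, k}` of the integer shifts of `h`. -/
def IsShiftAnalysis {I : Type*} (h : I → L2 d) (A : L2 d →L[ℂ] lp (fun _ : I × Zd d => ℂ) 2) :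
    Prop :=
  ∀ f i k, A f (i, k) = inner ℂ (shift (latticePoint k) (h i)) f

/-- The adjoint of the unitary dilation `f ↦ f_{M^j;0}`. -/
def dilateAdjoint (M : GL (Fin d) ℝ) (j : ℤ) : L2 d →L[ℂ] L2 d :=
  (dilateₗᵢ (M ^ j) 0).toContinuousLinearMap.adjoint

lemma IsShiftAnalysis.inner_affineFamily {I : Type*} {h : I → L2 d}
    {A : L2 d →L[ℂ] lp (fun _ : I × Zd d => ℂ) 2} (hA : IsShiftAnalysis h A) (M : GL (Fin d) ℝ)
    (p : ℤ × I × Zd d) (f : L2 d) :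
    inner ℂ (affineFamily M h p) f = A (dilateAdjoint M p.1 f) p.2 := by
  rw [← Prod.mk.eta (p := p.2), hA, dilateAdjoint, ContinuousLinearMap.adjoint_inner_right,
    affineFamily, dilate_eq_dilate_shift]
  rfl

lemma IsBessel.hasSum_norm_analysis {I : Type*} {h : I → L2 d}
    {A : L2 d →L[ℂ] lp (fun _ : I × Zd d => ℂ) 2} (hA : IsShiftAnalysis h A) {M : GL (Fin d) ℝ}
    {C : ℝ} (hB : IsBessel (affineFamily M h) C) (f : L2 d) :
    HasSum (fun j => ‖A (dilateAdjoint M j f)‖ ^ 2)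
      (∑' p, ‖inner ℂ (affineFamily M h p) f‖ ^ 2) := by
  refine (hB f).1.hasSum.prod_fiberwise fun j => ?_
  simp only [hA.inner_affineFamily]
  exact hasSum_norm_sq_lp _

/-- The Bessel bound of an affine system depends on its generators only through the norms `‖A f‖`,
since the sum over the level `j` is `‖A D_j⁎ f‖²`. -/
lemma IsBessel.of_norm_analysis_le {I ι : Type*} {g : I → L2 d} {h : ι → L2 d}
    {A : L2 d →L[ℂ] lp (fun _ : I × Zd d => ℂ) 2} (hA : IsShiftAnalysis g A)
    {B : L2 d →L[ℂ] lp (fun _ : ι × Zd d => ℂ) 2} (hB : IsShiftAnalysis h B)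
    (hBA : ∀ f, ‖B f‖ ≤ ‖A f‖) {M : GL (Fin d) ℝ} {C : ℝ} (hg : IsBessel (affineFamily M g) C) :
    IsBessel (affineFamily M h) C := by
  intro f
  have h1 := hg.hasSum_norm_analysis hA f
  have hle : ∀ j, ‖B (dilateAdjoint M j f)‖ ^ 2 ≤ ‖A (dilateAdjoint M j f)‖ ^ 2 := fun j => by
    gcongr; exact hBA _
  have hfib : ∀ j, HasSum (fun q => ‖inner ℂ (affineFamily M h (j, q)) f‖ ^ 2)
      (‖B (dilateAdjoint M j f)‖ ^ 2) := fun j => by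
    simp only [hB.inner_affineFamily]
    exact hasSum_norm_sq_lp _
  have h2 : Summable fun j => ‖B (dilateAdjoint M j f)‖ ^ 2 :=
    h1.summable.of_nonneg_of_le (fun j => by positivity) hle
  have h3 : Summable fun p => ‖inner ℂ (affineFamily M h p) f‖ ^ 2 := by
    refine (summable_prod_of_nonneg fun p => by positivity).2 ⟨fun j => (hfib j).summable, ?_⟩
    simpa only [(hfib _).tsum_eq] using h2
  refine ⟨h3, ?_⟩
  rw [h3.tsum_prod]
  simp only [(hfib _).tsum_eq]
  calc _ ≤ ∑' j, ‖A (dilateAdjoint M j f)‖ ^ 2 := h2.tsum_le_tsum hle h1.summable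
    _ = _ := h1.tsum_eq
    _ ≤ _ := (hg f).2

lemma tsum_inner_affineFamily {I : Type*} {h h' : I → L2 d}
    {A A' : L2 d →L[ℂ] lp (fun _ : I × Zd d => ℂ) 2} (hA : IsShiftAnalysis h A)
    (hA' : IsShiftAnalysis h' A') {M : GL (Fin d) ℝ} (f g : L2 d)
    (hs : Summable fun p => ‖inner ℂ (affineFamily M h p) f * inner ℂ g (affineFamily M h' p)‖) :
    ∑' p, inner ℂ (affineFamily M h p) f * inner ℂ g (affineFamily M h' p) =
      ∑' j, inner ℂ (A' (dilateAdjoint M j g)) (A (dilateAdjoint M j f)) := by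
  rw [hs.of_norm.tsum_prod]
  refine tsum_congr fun j => ?_
  rw [← (hasSum_inner_lp _ _).tsum_eq]
  refine tsum_congr fun q => ?_
  rw [hA.inner_affineFamily, ← inner_conj_symm g, hA'.inner_affineFamily, mul_comm]

/-- Two families may be replaced by others whose analysis operators are not larger in norm and have
the same mixed inner products. -/
lemma IsDualFrame.of_analysis {I ι : Type*} {g g' : I → L2 d} {h h' : ι → L2 d}
    {A A' : L2 d →L[ℂ] lp (fun _ : I × Zd d => ℂ) 2} (hA : IsShiftAnalysis g A)
    (hA' : IsShiftAnalysis g' A')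
    {B B' : L2 d →L[ℂ] lp (fun _ : ι × Zd d => ℂ) 2} (hB : IsShiftAnalysis h B)
    (hB' : IsShiftAnalysis h' B') (hBA : ∀ f, ‖B f‖ ≤ ‖A f‖) (hBA' : ∀ f, ‖B' f‖ ≤ ‖A' f‖)
    (hin : ∀ x y, inner ℂ (B' y) (B x) = inner ℂ (A' y) (A x)) {M : GL (Fin d) ℝ}
    (hd : IsDualFrame (affineFamily M g) (affineFamily M g')) :
    IsDualFrame (affineFamily M h) (affineFamily M h') := by
  obtain ⟨C, hC, hgC⟩ := hd.left.exists_isBessel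
  obtain ⟨D, hD, hgD⟩ := hd.right.exists_isBessel
  have hhC := hgC.of_norm_analysis_le hA hB hBA
  have hhD := hgD.of_norm_analysis_le hA' hB' hBA'
  refine isDualFrame_of_isBessel hC hD hhC hhD fun x y => ?_
  rw [tsum_inner_affineFamily hB hB' x y (summable_norm_inner_mul_inner hhC hhD x y),
    ← hd.tsum_eq x y, tsum_inner_affineFamily hA hA' x y (hd.summable_norm x y)]
  simp only [hin]

lemma IsDualFrame.exists_ne_zero {I : Type*} {M : GL (Fin d) ℝ} {h h' : I → L2 d}
    [Nontrivial (L2 d)] (hd : IsDualFrame (affineFamily M h) (affineFamily M h')) : h ≠ 0 := by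
  rintro rfl
  obtain ⟨f, hf⟩ := exists_ne (0 : L2 d)
  apply hf
  rw [← inner_self_eq_zero (𝕜 := ℂ), ← hd.tsum_eq f f]
  have : ∀ p, affineFamily M (0 : I → L2 d) p = 0 := fun p => (dilateₗᵢ _ _).map_zero
  simp [this]

lemma IsFrame.exists_isShiftAnalysis {I : Type*} {M : GL (Fin d) ℝ} {h : I → L2 d}
    (hh : IsFrame (affineFamily M h)) : ∃ A, IsShiftAnalysis h A := by
  obtain ⟨C, -, hC⟩ := hh.exists_isBessel
  obtain ⟨A, hA⟩ := (hC.comp_injective (Prod.mk_right_injective (0 : ℤ))).exists_analysis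
  refine ⟨A, fun f i k => ?_⟩
  rw [hA]
  simp only [Function.comp_apply, affineFamily, zpow_zero, shift]

section ShiftAnalysis

variable {I : Type*} {h : I → L2 d} {A : L2 d →L[ℂ] lp (fun _ : I × Zd d => ℂ) 2}

lemma inner_shift_left (k : Zd d) (f g : L2 d) :
    inner ℂ (shift (latticePoint k) f) g = inner ℂ f (shift (latticePoint (-k)) g) := by
  have h1 := (dilateₗᵢ 1 (latticePoint (-k))).inner_map_map (shift (latticePoint k) f) g
  rw [← h1]
  change inner ℂ (shift _ (shift _ f)) (shift _ g) = _
  rw [shift_shift, ← latticePoint_add, neg_add_cancel, latticePoint_zero, shift_zero]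

lemma IsShiftAnalysis.apply_shift (hA : IsShiftAnalysis h A) (k : Zd d) (f : L2 d) :
    A (shift (latticePoint k) f) = translation I k (A f) := by
  ext ⟨i, m⟩
  have h1 := inner_shift_left (-k) (shift (latticePoint m) (h i)) f
  rw [neg_neg] at h1
  rw [translation_apply, hA, hA, ← h1, shift_shift, ← latticePoint_add, neg_add_eq_sub]

lemma IsShiftAnalysis.adjoint_translation (hA : IsShiftAnalysis h A) (k : Zd d)
    (x : lp (fun _ : I × Zd d => ℂ) 2) :
    A.adjoint (translation I k x) = shift (latticePoint k) (A.adjoint x) := by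
  refine ext_inner_right ℂ fun f => ?_
  rw [ContinuousLinearMap.adjoint_inner_left, (isUnitaryAction_translation _ I).inner_left,
    ← hA.apply_shift, ← ContinuousLinearMap.adjoint_inner_left, inner_shift_left]

lemma IsShiftAnalysis.eq_zero_of_mem_orthogonal (hA : IsShiftAnalysis h A) {f : L2 d}
    (hf : f ∈ (shiftSpace (Set.range h))ᗮ) : A f = 0 := by
  ext ⟨i, k⟩
  rw [hA]
  exact (Submodule.mem_orthogonal _ _).1 hf _
    (Submodule.le_topologicalClosure _ (Submodule.subset_span ⟨h i, ⟨i, rfl⟩, k, rfl⟩))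

instance (Φ : Set (L2 d)) : CompleteSpace (shiftSpace Φ) :=
  (Submodule.isClosed_topologicalClosure _).completeSpace_coe

lemma IsShiftAnalysis.adjoint_mem (hA : IsShiftAnalysis h A) (x : lp (fun _ : I × Zd d => ℂ) 2) :
    A.adjoint x ∈ shiftSpace (Set.range h) := by
  rw [← (shiftSpace (Set.range h)).orthogonal_orthogonal, Submodule.mem_orthogonal']
  intro f hf
  rw [ContinuousLinearMap.adjoint_inner_left, hA.eq_zero_of_mem_orthogonal hf, inner_zero_right]

/-- The range of `A` is controlled by any generating set `Φ` of the shift-invariant space: `A`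
vanishes on the orthogonal complement of that space. -/
lemma IsShiftAnalysis.apply_mem (hA : IsShiftAnalysis h A) {Φ : Set (L2 d)}
    (hΦ : shiftSpace (Set.range h) = shiftSpace Φ)
    {R : Submodule ℂ (lp (fun _ : I × Zd d => ℂ) 2)}
    (hRc : IsClosed (R : Set (lp (fun _ : I × Zd d => ℂ) 2)))
    (hR : ∀ k, ∀ x ∈ R, translation I k x ∈ R) (hΦR : ∀ φ ∈ Φ, A φ ∈ R) (f : L2 d) : A f ∈ R := by
  have h1 : shiftSpace Φ ≤ R.comap A.toLinearMap := by
    refine Submodule.topologicalClosure_minimal _ (Submodule.span_le.2 ?_)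
      (hRc.preimage A.continuous)
    rintro _ ⟨φ, hφ, k, rfl⟩
    change A (shift (latticePoint k) φ) ∈ R
    rw [hA.apply_shift]
    exact hR k _ (hΦR φ hφ)
  have h2 := hA.eq_zero_of_mem_orthogonal
    ((shiftSpace (Set.range h)).sub_starProjection_mem_orthogonal f)
  rw [map_sub, sub_eq_zero] at h2
  rw [h2]
  exact h1 (hΦ ▸ Submodule.starProjection_apply_mem _ f)

end ShiftAnalysis

/-- The reduction of the number of generators: pulling Parseval generators of a subspace `R` that
contains the range of `A` back to `L_2(ℝ^d)` gives generators of dual affine frames. The range of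
`A'` need not lie in `R`. -/
lemma IsDualFrame.of_isParsevalGenerator {I ι : Type*} {g g' : I → L2 d}
    {A A' : L2 d →L[ℂ] lp (fun _ : I × Zd d => ℂ) 2} (hA : IsShiftAnalysis g A)
    (hA' : IsShiftAnalysis g' A') {R : Submodule ℂ (lp (fun _ : I × Zd d => ℂ) 2)}
    [CompleteSpace R] (hAR : ∀ f, A f ∈ R) {p : ι → lp (fun _ : I × Zd d => ℂ) 2}
    (hp : IsParsevalGenerator (translation I) p R) {M : GL (Fin d) ℝ}
    (hd : IsDualFrame (affineFamily M g) (affineFamily M g')) :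
    IsDualFrame (affineFamily M fun l => A.adjoint (p l))
      (affineFamily M fun l => A'.adjoint (p l)) := by
  have hpB : IsBessel (fun i : ι × Zd d => translation I i.2 (p i.1)) 1 := fun x => by
    refine ⟨(hp x).summable, ?_⟩
    rw [(hp x).tsum_eq, one_mul]
    gcongr
    exact R.norm_starProjection_apply_le x
  obtain ⟨W, hW⟩ := hpB.exists_analysis
  have hWn : ∀ x, ‖W x‖ = ‖R.starProjection x‖ := fun x => by
    rw [← sq_eq_sq₀ (norm_nonneg _) (norm_nonneg _), ← (hasSum_norm_sq_lp (W x)).tsum_eq,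
      ← (hp x).tsum_eq]
    simp only [hW]
  have hWin : ∀ x y, inner ℂ (W x) (W y) = inner ℂ (R.starProjection x) (R.starProjection y) := by
    intro x y
    rw [inner_eq_sum_norm_sq_div_four, inner_eq_sum_norm_sq_div_four]
    simp only [← map_add, ← map_sub, ← map_smul, hWn]
  have hcomp : ∀ {k : I → L2 d} {T : L2 d →L[ℂ] lp (fun _ : I × Zd d => ℂ) 2},
      IsShiftAnalysis k T → IsShiftAnalysis (fun l => T.adjoint (p l)) (W.comp T) := by
    intro k T hT f l m
    rw [← hT.adjoint_translation, ContinuousLinearMap.adjoint_inner_left]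
    exact hW _ _
  have hle : ∀ x, ‖W x‖ ≤ ‖x‖ := fun x => (hWn x).trans_le (R.norm_starProjection_apply_le x)
  refine IsDualFrame.of_analysis hA hA' (hcomp hA) (hcomp hA') (fun f => hle _) (fun f => hle _)
    (fun x y => ?_) hd
  rw [ContinuousLinearMap.comp_apply, ContinuousLinearMap.comp_apply, hWin,
    Submodule.inner_starProjection_left_eq_right,
    Submodule.starProjection_eq_self_iff.2 (R.starProjection_apply_mem _),
    Submodule.starProjection_eq_self_iff.2 (hAR x)]

lemma householder_injective_of_inner {E : Type*} [NormedAddCommGroup E] [InnerProductSpace ℂ E]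
    {n : ℕ} {z : Fin n → ℝ} {h : Fin n → E} {g : E}
    (hz : Function.Injective (householder z fun l => inner ℂ g (h l))) :
    Function.Injective (householder z h) := fun i j hij => hz (by
  have h1 := map_householder (innerSL ℂ g).toLinearMap z h
  have h2 := (h1 i).symm.trans ((congrArg _ hij).trans (h1 j))
  exact h2)

/-- If `S(g)` has `n` distinct generators, then there are dual affine frames with `n` distinct
generators on either side. -/
lemma IsDualFrame.exists_fin {I : Type*} [Countable I] {g g' : I → L2 d} {M : GL (Fin d) ℝ}
    (hd : IsDualFrame (affineFamily M g) (affineFamily M g')) {n : ℕ} {φ : Fin n → L2 d}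
    (hφ : Function.Injective φ)
    (hgφ : shiftSpace (Set.range g) = shiftSpace (Set.range φ)) :
    ∃ h h' : Fin n → L2 d, Function.Injective h ∧ Function.Injective h' ∧
      (∀ l, h l ∈ shiftSpace (Set.range g)) ∧ (∀ l, h' l ∈ shiftSpace (Set.range g')) ∧
      IsDualFrame (affineFamily M h) (affineFamily M h') := by
  obtain ⟨A, hA⟩ := hd.left.exists_isShiftAnalysis
  obtain ⟨A', hA'⟩ := hd.right.exists_isShiftAnalysis
  obtain ⟨R, hRc, p, hRU, hφR, hp⟩ := exists_parsevalGenerator_translation fun l => A (φ l)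
  have hAR : ∀ f, A f ∈ R := hA.apply_mem hgφ
    (completeSpace_coe_iff_isComplete.1 hRc).isClosed hRU
    (by rintro _ ⟨l, rfl⟩; exact hφR l)
  -- Parseval generators with distinct images on both sides
  obtain ⟨q, hq, hinj, hinj'⟩ : ∃ q, IsParsevalGenerator (translation I) q R ∧
      Function.Injective (fun l : Fin n => A.adjoint (q l)) ∧
      Function.Injective (fun l : Fin n => A'.adjoint (q l)) := by
    rcases subsingleton_or_nontrivial (Fin n) with hn | hn
    · exact ⟨p, hp, Function.injective_of_subsingleton _, Function.injective_of_subsingleton _⟩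
    -- two distinct generators `φ` show that `L_2(ℝ^d)` is nonzero
    have : Nontrivial (L2 d) := hφ.nontrivial
    have hd' := IsDualFrame.of_isParsevalGenerator hA hA' hAR hp hd
    obtain ⟨i, hi⟩ := Function.ne_iff.1 hd'.exists_ne_zero
    obtain ⟨j, hj⟩ := Function.ne_iff.1 hd'.symm.exists_ne_zero
    obtain ⟨z, hz, hz1, hz2⟩ := exists_householder_injective
      (fun l => inner ℂ (A.adjoint (p i)) (A.adjoint (p l)))
      (fun l => inner ℂ (A'.adjoint (p j)) (A'.adjoint (p l)))
      (Function.ne_iff.2 ⟨i, inner_self_ne_zero.2 hi⟩)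
      (Function.ne_iff.2 ⟨j, inner_self_ne_zero.2 hj⟩)
    refine ⟨householder z p, hp.householder hz, ?_, ?_⟩
    · have := householder_injective_of_inner hz1
      exact fun a b hab => this
        (((map_householder A.adjoint.toLinearMap z p a).symm.trans hab).trans
          (map_householder A.adjoint.toLinearMap z p b))
    · have := householder_injective_of_inner hz2
      exact fun a b hab => this
        (((map_householder A'.adjoint.toLinearMap z p a).symm.trans hab).trans
          (map_householder A'.adjoint.toLinearMap z p b))
  exact ⟨_, _, hinj, hinj', fun l => hA.adjoint_mem _, fun l => hA'.adjoint_mem _,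
    IsDualFrame.of_isParsevalGenerator hA hA' hAR hq hd⟩

lemma isHomogeneousDualFramelet_iff {M : GL (Fin d) ℝ} {Ψ Ψ' : Set (L2 d)} {e : Ψ ≃ Ψ'} :
    IsHomogeneousDualFramelet M Ψ' Ψ e ↔ Ψ.Countable ∧ Ψ'.Countable ∧
      IsDualFrame (affineFamily M fun ψ : Ψ => (ψ : L2 d))
        (affineFamily M fun ψ : Ψ => (e ψ : L2 d)) := by
  let φ : ℤ × Ψ × Zd d ≃ ℤ × Ψ' × Zd d :=
    (Equiv.refl ℤ).prodCongr (e.prodCongr (Equiv.refl (Zd d)))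
  have hφ : (affineFamily M fun ψ : Ψ => (e ψ : L2 d)) = affineSystem M Ψ' ∘ φ := rfl
  constructor
  · rintro ⟨⟨h1, h2⟩, ⟨h3, h4⟩, h5, h6⟩
    exact ⟨h1, h3, h2, hφ ▸ (IsFrame.comp_equiv_iff φ).2 h4, h5, h6⟩
  · rintro ⟨h1, h3, h2, h4, h5, h6⟩
    exact ⟨⟨h1, h2⟩, ⟨h3, (IsFrame.comp_equiv_iff φ).1 (hφ ▸ h4)⟩, h5, h6⟩

lemma IsHomogeneousDualFramelet.symm {M : GL (Fin d) ℝ} {Ψ Ψ' : Set (L2 d)} {e : Ψ ≃ Ψ'}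
    (h : IsHomogeneousDualFramelet M Ψ' Ψ e) : IsHomogeneousDualFramelet M Ψ Ψ' e.symm := by
  rw [isHomogeneousDualFramelet_iff] at h ⊢
  refine ⟨h.2.1, h.1, ?_⟩
  rw [← IsDualFrame.comp_equiv_iff ((Equiv.refl ℤ).prodCongr (e.prodCongr (Equiv.refl (Zd d))))]
  convert h.2.2.symm using 1
  all_goals
    ext1 p
    simp [affineFamily]

lemma isHomogeneousDualFramelet_range {M : GL (Fin d) ℝ} {ι : Type*} [Countable ι]
    {h h' : ι → L2 d} (hh : Function.Injective h) (hh' : Function.Injective h')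
    (hd : IsDualFrame (affineFamily M h) (affineFamily M h')) :
    IsHomogeneousDualFramelet M (Set.range h') (Set.range h)
      ((Equiv.ofInjective h hh).symm.trans (Equiv.ofInjective h' hh')) := by
  rw [isHomogeneousDualFramelet_iff]
  refine ⟨Set.countable_range h, Set.countable_range h', ?_⟩
  rw [← IsDualFrame.comp_equiv_iff ((Equiv.refl ℤ).prodCongr
    ((Equiv.ofInjective h hh).prodCongr (Equiv.refl (Zd d))))]
  convert hd using 1
  all_goals
    ext1 p
    simp [affineFamily]

lemma exists_eq_shiftSpace_range_of_len_eq {S : Submodule ℂ (L2 d)} {n : ℕ}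
    (h : len S = (n : ℕ∞)) :
    ∃ φ : Fin n → L2 d, Function.Injective φ ∧ S = shiftSpace (Set.range φ) := by
  have hne : {m : ℕ∞ | ∃ Φ : Set (L2 d), S = shiftSpace Φ ∧ m = Φ.encard}.Nonempty := by
    by_contra hemp
    rw [Set.not_nonempty_iff_eq_empty] at hemp
    rw [len, hemp, sInf_empty] at h
    exact ENat.natCast_ne_top n h.symm
  obtain ⟨Φ, hΦ, hcard⟩ := csInf_mem hne
  have hΦn : Φ.encard = n := hcard.symm.trans h
  have hfin : Finite Φ := Set.finite_of_encard_eq_coe hΦn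
  have hnc : Nat.card Φ = n := by
    rw [Nat.card_coe_set_eq, Set.ncard, hΦn, ENat.toNat_natCast]
  let E := Finite.equivFinOfCardEq hnc
  refine ⟨fun i => E.symm i, Subtype.val_injective.comp E.symm.injective, ?_⟩
  rw [hΦ]
  congr 1
  ext x
  constructor
  · intro hx
    exact ⟨E ⟨x, hx⟩, by simp⟩
  · rintro ⟨i, rfl⟩
    exact (E.symm i).2

/-- The number of generators can be lowered to the length of `S(Ψ)`. -/
lemma IsHomogeneousDualFramelet.exists_of_len_eq {M : GL (Fin d) ℝ} {Ψ Ψ' : Set (L2 d)}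
    {e : Ψ ≃ Ψ'} (hd : IsHomogeneousDualFramelet M Ψ' Ψ e) {n : ℕ}
    (hn : len (shiftSpace Ψ) = (n : ℕ∞)) :
    ∃ (H H' : Set (L2 d)) (e' : H ≃ H'), H ⊆ (shiftSpace Ψ : Set (L2 d)) ∧
      H' ⊆ (shiftSpace Ψ' : Set (L2 d)) ∧ H.encard = (n : ℕ∞) ∧ H'.encard = (n : ℕ∞) ∧
      IsHomogeneousDualFramelet M H' H e' := by
  obtain ⟨hc, -, hdf⟩ := isHomogeneousDualFramelet_iff.1 hd
  have : Countable Ψ := hc.to_subtype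
  obtain ⟨φ, hφ, hS⟩ := exists_eq_shiftSpace_range_of_len_eq hn
  have hr : Set.range (fun ψ : Ψ => (ψ : L2 d)) = Ψ := Subtype.range_coe
  have hr' : Set.range (fun ψ : Ψ => (e ψ : L2 d)) = Ψ' := by
    exact (e.surjective.range_comp Subtype.val).trans Subtype.range_coe
  obtain ⟨h, h', hh, hh', hm, hm', hdh⟩ := hdf.exists_fin hφ (hr.symm ▸ hS)
  rw [hr] at hm
  rw [hr'] at hm'
  have hcard : ∀ k : Fin n → L2 d, Function.Injective k → (Set.range k).encard = n := by
    intro k hk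
    rw [← Set.image_univ, hk.encard_image, Set.encard_univ]
    simp
  exact ⟨_, _, _, Set.range_subset_iff.2 hm, Set.range_subset_iff.2 hm', hcard h hh, hcard h' hh',
    isHomogeneousDualFramelet_range hh hh' hdh⟩

end AffineSystem

end Framelet

end

theorem corollary4p2 {d : ℕ} (M : GL (Fin d) ℝ)
    (Ψ Ψ' : Set (Framelet.L2 d)) (e : Ψ ≃ Ψ')
    (hΨ : Ψ.Countable) (hΨ' : Ψ'.Countable)
    (hsum : Summable (fun ψ : Ψ => ‖(ψ : Framelet.L2 d)‖ ^ 2))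
    (hsum' : Summable (fun ψ : Ψ' => ‖(ψ : Framelet.L2 d)‖ ^ 2))
    (s : ℕ)
    (hs : min (Framelet.len (Framelet.shiftSpace Ψ)) (Framelet.len (Framelet.shiftSpace Ψ')) =
      (s : ℕ∞))
    (hdual : Framelet.IsHomogeneousDualFramelet M Ψ' Ψ e) :
    ∃ (H H' : Set (Framelet.L2 d)) (e' : H ≃ H'),
      H ⊆ (Framelet.shiftSpace Ψ : Set (Framelet.L2 d)) ∧
      H' ⊆ (Framelet.shiftSpace Ψ' : Set (Framelet.L2 d)) ∧
      H.encard = (s : ℕ∞) ∧ H'.encard = (s : ℕ∞) ∧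
      Framelet.IsHomogeneousDualFramelet M H' H e' := by
  rcases min_choice (Framelet.len (Framelet.shiftSpace Ψ))
    (Framelet.len (Framelet.shiftSpace Ψ')) with h | h
  · exact hdual.exists_of_len_eq (h.symm.trans hs)
  · obtain ⟨H', H, e', h1, h2, h3, h4, h5⟩ := hdual.symm.exists_of_len_eq (h.symm.trans hs)
    exact ⟨H, H', e'.symm, h2, h1, h4, h3, h5.symm⟩
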